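/- **Calculus.** Consider the $\pi$-calculus over a countably infinite set of names, with processes $P ::= {!G} \mid P|Q \mid (\nu a)P \mid G$ and guarded sums $G ::= 0 \mid \bar a b.P \mid a(b).P \mid \tau.P \mid G+G'$, taken up to renaming of bound names, with its usual early labelled transitions $P\xrightarrow{\mu}P'$, where $\mu$ is $\tau$ or a visible action $\alpha$: a free output $\bar a b$, a bound output $(\nu b)\bar a b$ or an input $ab$; replication has the rule that $!G\,|\,G\xrightarrow{\mu}P'$ implies $!G\xrightarrow{\mu}P'$. Let $\Rightarrow$ be the reflexive transitive closure of $\xrightarrow{\tau}$, let $\xRightarrow{\mu}$ be $\Rightarrow\xrightarrow{\mu}\Rightarrow$, and let $\hat{\xRightarrow{\mu}}$ be $\Rightarrow$ if $\mu=\tau$ and $\xRightarrow{\mu}$ otherwise. Let $\equiv$ be structural congruence. Substitutions $\sigma$ map names to names and act simultaneously on free names. **Hypotheses.** Let $\mathcal P$ be a set of processes that is closed under transitions and has the *weak aliased communication property*: for all $P\in\mathcal P$, - $P\xRightarrow{\bar a b}\xRightarrow{cb}P'$ implies $P\sigma\Rightarrow\equiv P'\sigma$ for all $\sigma$ with $\sigma(a)=\sigma(c)$;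 - $P\xRightarrow{(\nu b)\bar a b}\xRightarrow{cb}P'$ implies $P\sigma\Rightarrow\equiv(\nu b)(P'\sigma)$ for all $\sigma$ with $\sigma(a)=\sigma(c)$ for which $b$ is fresh ($\sigma(b)=b$, and $\sigma(x)\neq b$ for $x\ne b$). **Bisimulation and expansion.** For a relation $\mathcal R$ on processes, $ws(\mathcal R)$ is the set of pairs $(P,Q)$ such that $P\xrightarrow{\mu}P'$, with the bound name of $\mu$ (if any) not free in $Q$, implies that there is $Q'$ with $Q\hat{\xRightarrow{\mu}}Q'$ and $P'\mathrel{\mathcal R}Q'$. Further, $wb(\mathcal R)=ws(\mathcal R)\cap (ws(\mathcal R^{-1}))^{-1}$ and $\overline{wb}(\mathcal R)=\mathcal R\cap wb(\mathcal R)$. The expansion preorder $\gtrsim$ is the largest relation $\mathcal R$ such that, whenever $P\mathrel{\mathcal R}Q$: each $P\xrightarrow{\mu}P'$ is matched by some $Q'$ with $P'\mathrel{\mathcal R}Q'$, where $Q\xrightarrow{\mu}Q'$ or ($\mu=\tau$ and $Q'=Q$); and each $Q\xrightarrow{\mu}Q'$ is matched by some $P'$ with $P\hat{\xRightarrow{\mu}}P'$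 and $P'\mathrel{\mathcal R}Q'$ (bound names of $\mu$ being fresh as before). **Up-to techniques.** Define - $\mathcal F_{\gtrsim}(\mathcal R)=\{(P,Q)\mid P\gtrsim P_0\mathrel{\mathcal R}Q_0\lesssim Q \text{ for some } P_0,Q_0\}$, $\ id(\mathcal R)=\mathcal R$, $\ \mathtt{refl}(\mathcal R)=\{(P,P)\}$; - $\mathtt{sub}(\mathcal R)=\{(P\sigma,Q\sigma)\mid P\mathrel{\mathcal R}Q\}$, $\ \mathtt{res}(\mathcal R)=\{((\nu\tilde a)P,(\nu\tilde a)Q)\mid P\mathrel{\mathcal R}Q\}$; - $\mathtt{pcomp}(\mathcal R)=\{(P|P',Q|Q')\mid P\mathrel{\mathcal R}Q,\ P'\mathrel{\mathcal R}Q'\}$, $\ \mathtt{rep}(\mathcal R)=\{(!G,!G')\mid G\mathrel{\mathcal R}G'\}$; - $\mathtt{tau}(\mathcal R)=\{(\tau.P,\tau.Q)\mid P\mathrel{\mathcal R}Q\}$, $\ \mathtt{out}(\mathcal R)=\{(\bar ab.P,\bar ab.Q)\mid P\mathrel{\mathcal R}Q\}$, $\ \mathtt{inp}(\mathcal R)=\{(a(b).P,a(b).Q)\mid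 P\mathrel{\mathcal R}Q\}$; - $\mathtt{sum_g}(\mathcal R)=\{(\sum_iG_i,\sum_iG'_i)\mid \forall i,\ (G_i,G'_i)\in(\mathtt{tau}\cup\mathtt{out}\cup\mathtt{inp}\cup\mathtt{refl})(\mathcal R)\}$, for finite sums. All these functions, and $\overline{wb}$, are taken on relations on $\mathcal P$, i.e. $f$ stands for $\mathcal R\mapsto f(\mathcal R)\cap(\mathcal P\times\mathcal P)$ with $\mathcal R\subseteq\mathcal P\times\mathcal P$. Let $f^\omega=\bigcup_{i\ge0}f^i$. Call $f$ *$g$-sound* if there is a function $f'$ with $\mathcal R\subseteq f'(\mathcal R)$ for all $\mathcal R$ such that $\mathcal R\subseteq g(f(\mathcal R))$ implies $f'(\mathcal R)\subseteq g(f'(\mathcal R))$. **Theorem.** For every such $\mathcal P$, $$(\mathcal F_{\gtrsim}\cup id\cup\mathtt{refl}\cup\mathtt{sub}\cup\mathtt{res}\cup\mathtt{pcomp}\cup\mathtt{sum_g}\cup\mathtt{rep}\cup\mathtt{tau}\cup\mathtt{out}\cup\mathtt{inp})^\omega\ \text{ is }\ \overline{wb}\text{-sound.}$$ -/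

import Mathlib

namespace PiCalc

/-! ## Syntax

Bound names are de Bruijn indices and free names are elements of a countably infinite set, so that
syntactic equality is equality up to renaming of bound names. -/

/-- The countably infinite set of names. -/
abbrev Name := ℕ

/-- Name occurrences below `n` binders: a free name, or a reference to one of the binders. -/
inductive Nm (n : ℕ) : Type
  | free (a : Name) : Nm n
  | bound (i : Fin n) : Nm n

/-- The two syntactic categories: guarded sums `G` and processes `P`. -/
inductive Kind : Type
  | guard
  | proc

/-- Terms of the pi-calculus below `n` binders:
`P ::= !G | P|Q | (ν a)P | G` and `G ::= 0 | a̅b.P | a(b).P | τ.P | G+G'`. -/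
inductive Tm : Kind → ℕ → Type
  | nil {n : ℕ} : Tm .guard n
  | out {n : ℕ} (a b : Nm n) (P : Tm .proc n) : Tm .guard n
  | inp {n : ℕ} (a : Nm n) (P : Tm .proc (n + 1)) : Tm .guard n
  | tau {n : ℕ} (P : Tm .proc n) : Tm .guard n
  | plus {n : ℕ} (G H : Tm .guard n) : Tm .guard n
  | rep {n : ℕ} (G : Tm .guard n) : Tm .proc n
  | par {n : ℕ} (P Q : Tm .proc n) : Tm .proc n
  | res {n : ℕ} (P : Tm .proc (n + 1)) : Tm .proc n
  | ofGuard {n : ℕ} (G : Tm .guard n) : Tm .proc n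

/-- Processes up to renaming of bound names. -/
abbrev Proc := Tm .proc 0

/-- Guarded sums up to renaming of bound names. -/
abbrev Guard := Tm .guard 0

/-- Pass below one more binder. -/
def Nm.weaken {n : ℕ} : Nm n → Nm (n + 1)
  | .free a => .free a
  | .bound i => .bound i.succ

/-- Extend a map on name occurrences below a binder (index `0` is the new binder). -/
def Nm.lift {n m : ℕ} (f : Nm n → Nm m) : Nm (n + 1) → Nm (m + 1)
  | .free a => (f (.free a)).weaken
  | .bound i => Fin.cases (.bound 0) (fun j => (f (.bound j)).weaken) i

/-- Simultaneous capture-avoiding replacement of name occurrences. -/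
def Tm.map {k : Kind} {n m : ℕ} (f : Nm n → Nm m) : Tm k n → Tm k m
  | .nil => .nil
  | .out a b P => .out (f a) (f b) (P.map f)
  | .inp a P => .inp (f a) (P.map (Nm.lift f))
  | .tau P => .tau (P.map f)
  | .plus G H => .plus (G.map f) (H.map f)
  | .rep G => .rep (G.map f)
  | .par P Q => .par (P.map f) (Q.map f)
  | .res P => .res (P.map (Nm.lift f))
  | .ofGuard G => .ofGuard (G.map f)

/-- The free name, if any, at a name occurrence. -/
def Nm.fn {n : ℕ} : Nm n → Finset Name
  | .free a => {a}
  | .bound _ => ∅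

/-- Free names. -/
def Tm.fn {k : Kind} {n : ℕ} : Tm k n → Finset Name
  | .nil => ∅
  | .out a b P => a.fn ∪ b.fn ∪ P.fn
  | .inp a P => a.fn ∪ P.fn
  | .tau P => P.fn
  | .plus G H => G.fn ∪ H.fn
  | .rep G => G.fn
  | .par P Q => P.fn ∪ Q.fn
  | .res P => P.fn
  | .ofGuard G => G.fn

/-- `P.subst σ` is `Pσ`. -/
def Tm.subst {k : Kind} {n : ℕ} (σ : Name → Name) (P : Tm k n) : Tm k n :=
  P.map fun
    | .free a => .free (σ a)
    | .bound i => .bound i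

/-- The body of a binder, with `b` put for the bound name. -/
def Tm.inst {k : Kind} (b : Name) (P : Tm k 1) : Tm k 0 :=
  P.map fun
    | .free a => .free a
    | .bound _ => .free b

/-- Bind the free name `b`. -/
def Tm.close {k : Kind} (b : Name) (P : Tm k 0) : Tm k 1 :=
  P.map fun
    | .free a => if a = b then .bound 0 else .free a
    | .bound i => i.elim0

/-- `(ν a)P` -/
def nu (a : Name) (P : Proc) : Proc := .res (P.close a)

/-- `(ν a₁)…(ν aₖ)P` -/
def nus (as : List Name) (P : Proc) : Proc := as.foldr nu P

/-- `a̅b.P` -/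
def outP (a b : Name) (P : Proc) : Guard := .out (.free a) (.free b) P

/-- `a(b).P` -/
def inpP (a b : Name) (P : Proc) : Guard := .inp (.free a) (P.close b)

/-- The process `0`. -/
def nilP : Proc := .ofGuard .nil

/-! ## Early labelled transition system -/

/-- Labels `μ`: the silent label, free output `a̅b`, bound output `(ν b)a̅b`, early input `ab`. -/
inductive Label : Type
  | tau
  | out (a b : Name)
  | bout (a b : Name)
  | inp (a b : Name)

/-- Bound names of a label. -/
def Label.bn : Label → Finset Name
  | .bout _ b => {b}
  | _ => ∅

/-- All names of a label. -/
def Label.names : Label → Finset Name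
  | .tau => ∅
  | .out a b => {a, b}
  | .bout a b => {a, b}
  | .inp a b => {a, b}

/-- Transitions. In the two rules for restriction, the restricted process is `(ν b)(P.inst b)`
for any name `b` that is not free in `.res P`. -/
inductive Step : Proc → Label → Proc → Prop
  | inp (a c : Name) (P : Tm .proc 1) :
      Step (.ofGuard (.inp (.free a) P)) (.inp a c) (P.inst c)
  | out (a b : Name) (P : Proc) :
      Step (.ofGuard (.out (.free a) (.free b) P)) (.out a b) P
  | tau (P : Proc) : Step (.ofGuard (.tau P)) .tau P
  | sumL {G H : Guard} {μ : Label} {P' : Proc} :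
      Step (.ofGuard G) μ P' → Step (.ofGuard (.plus G H)) μ P'
  | sumR {G H : Guard} {μ : Label} {P' : Proc} :
      Step (.ofGuard H) μ P' → Step (.ofGuard (.plus G H)) μ P'
  | rep {G : Guard} {μ : Label} {P' : Proc} :
      Step (.par (.rep G) (.ofGuard G)) μ P' → Step (.rep G) μ P'
  | opn {P : Tm .proc 1} {a b : Name} {P' : Proc} :
      b ∉ P.fn → b ≠ a → Step (P.inst b) (.out a b) P' → Step (.res P) (.bout a b) P'
  | res {P : Tm .proc 1} {b : Name} {μ : Label} {P' : Proc} :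
      b ∉ P.fn → b ∉ μ.names → Step (P.inst b) μ P' → Step (.res P) μ (nu b P')
  | parL {P Q P' : Proc} {μ : Label} :
      Disjoint μ.bn Q.fn → Step P μ P' → Step (.par P Q) μ (.par P' Q)
  | parR {P Q Q' : Proc} {μ : Label} :
      Disjoint μ.bn P.fn → Step Q μ Q' → Step (.par P Q) μ (.par P Q')
  | commL {P Q P' Q' : Proc} {a b : Name} :
      Step P (.inp a b) P' → Step Q (.out a b) Q' → Step (.par P Q) .tau (.par P' Q')
  | commR {P Q P' Q' : Proc} {a b : Name} :
      Step P (.out a b) P' → Step Q (.inp a b) Q' → Step (.par P Q) .tau (.par P' Q')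
  | closeL {P Q P' Q' : Proc} {a b : Name} :
      b ∉ P.fn → Step P (.inp a b) P' → Step Q (.bout a b) Q' →
        Step (.par P Q) .tau (nu b (.par P' Q'))
  | closeR {P Q P' Q' : Proc} {a b : Name} :
      b ∉ Q.fn → Step P (.bout a b) P' → Step Q (.inp a b) Q' →
        Step (.par P Q) .tau (nu b (.par P' Q'))

/-- Reflexive transitive closure of silent transitions. -/
def TauStar : Proc → Proc → Prop := Relation.ReflTransGen fun P Q => Step P .tau Q

/-- A `μ`-transition with silent transitions before and after it. -/
def WStep (P : Proc) (μ : Label) (P' : Proc) : Prop :=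
  ∃ P₁ P₂, TauStar P P₁ ∧ Step P₁ μ P₂ ∧ TauStar P₂ P'

/-- As `WStep`, but any number (including zero) of silent transitions if `μ = τ`. -/
def WStepHat (P : Proc) : Label → Proc → Prop
  | .tau, P' => TauStar P P'
  | μ, P' => WStep P μ P'

/-- One `μ`-transition, or possibly none if `μ = τ`. -/
def StepHat (P : Proc) : Label → Proc → Prop
  | .tau, P' => P = P' ∨ Step P .tau P'
  | μ, P' => Step P μ P'

/-- Structural congruence (on processes and on guarded sums). -/
inductive StructCong : {k : Kind} → Tm k 0 → Tm k 0 → Prop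
  | refl {k : Kind} (P : Tm k 0) : StructCong P P
  | symm {k : Kind} {P Q : Tm k 0} : StructCong P Q → StructCong Q P
  | trans {k : Kind} {P Q R : Tm k 0} : StructCong P Q → StructCong Q R → StructCong P R
  | out (a b : Name) {P Q : Proc} : StructCong P Q → StructCong (outP a b P) (outP a b Q)
  | inp (a b : Name) {P Q : Proc} : StructCong P Q → StructCong (inpP a b P) (inpP a b Q)
  | tau {P Q : Proc} : StructCong P Q → StructCong (Tm.tau P) (Tm.tau Q)
  | plus {G G' H H' : Guard} :
      StructCong G G' → StructCong H H' → StructCong (Tm.plus G H) (Tm.plus G' H')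
  | rep {G H : Guard} : StructCong G H → StructCong (Tm.rep G) (Tm.rep H)
  | par {P P' Q Q' : Proc} :
      StructCong P P' → StructCong Q Q' → StructCong (Tm.par P Q) (Tm.par P' Q')
  | nu (a : Name) {P Q : Proc} : StructCong P Q → StructCong (nu a P) (nu a Q)
  | ofGuard {G H : Guard} : StructCong G H → StructCong (Tm.ofGuard G) (Tm.ofGuard H)
  | plus_assoc (G H K : Guard) : StructCong (Tm.plus (Tm.plus G H) K) (Tm.plus G (Tm.plus H K))
  | plus_comm (G H : Guard) : StructCong (Tm.plus G H) (Tm.plus H G)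
  | plus_nil (G : Guard) : StructCong (Tm.plus G Tm.nil) G
  | par_assoc (P Q R : Proc) : StructCong (Tm.par (Tm.par P Q) R) (Tm.par P (Tm.par Q R))
  | par_comm (P Q : Proc) : StructCong (Tm.par P Q) (Tm.par Q P)
  | par_nil (P : Proc) : StructCong (Tm.par P nilP) P
  | nu_nil (a : Name) : StructCong (PiCalc.nu a nilP) nilP
  | nu_comm (a b : Name) (P : Proc) :
      StructCong (PiCalc.nu a (PiCalc.nu b P)) (PiCalc.nu b (PiCalc.nu a P))
  | nu_par (a : Name) (P Q : Proc) :
      a ∉ Q.fn → StructCong (PiCalc.nu a (Tm.par P Q)) (Tm.par (PiCalc.nu a P) Q)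
  | rep_unfold (G : Guard) : StructCong (Tm.rep G) (Tm.par (Tm.rep G) (Tm.ofGuard G))

/-- The weak aliased communication property of a set of processes. In the second clause the
extruded name `b` is fresh for the substitution, as bound names always are. -/
def WeakAliasedCommunication (S : Set Proc) : Prop :=
  ∀ P ∈ S,
    (∀ (a b c : Name) (P₁ P' : Proc) (σ : Name → Name),
      WStep P (.out a b) P₁ → WStep P₁ (.inp c b) P' → σ a = σ c →
        ∃ N, TauStar (P.subst σ) N ∧ StructCong N (P'.subst σ)) ∧
    (∀ (a b c : Name) (P₁ P' : Proc) (σ : Name → Name),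
      WStep P (.bout a b) P₁ → WStep P₁ (.inp c b) P' →
        σ b = b → (∀ x, σ x = b → x = b) → σ a = σ c →
        ∃ N, TauStar (P.subst σ) N ∧ StructCong N (nu b (P'.subst σ)))

/-- Closure under transitions, for a set of processes to be a subcalculus. -/
def ClosedUnderTransitions (S : Set Proc) : Prop :=
  ∀ P ∈ S, ∀ (μ : Label) (P' : Proc), Step P μ P' → P' ∈ S

/-! ## Functions on relations and soundness -/

/-- Binary relations, ordered by inclusion. -/
abbrev BinRel (X : Type) := X → X → Prop

/-- `R ⊆ f(R)` for all `R`. -/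
def Extensive {X : Type} (f : BinRel X → BinRel X) : Prop := ∀ R, R ≤ f R

/-- `f` is `g`-sound via `f'`. -/
def SoundVia {X : Type} (g f f' : BinRel X → BinRel X) : Prop :=
  Extensive f' ∧ ∀ R, R ≤ g (f R) → f' R ≤ g (f' R)

/-- `f` is `g`-sound. -/
def Sound {X : Type} (g f : BinRel X → BinRel X) : Prop := ∃ f', SoundVia g f f'

/-- `f^ω`, the union of the finite iterates of `f`. -/
def omegaIter {X : Type} (f : BinRel X → BinRel X) (R : BinRel X) : BinRel X :=
  ⨆ i : ℕ, f^[i] R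

/-- A relation on a set of processes, seen as a relation on all processes. -/
def extend (S : Set Proc) (R : BinRel S) : BinRel Proc :=
  fun P Q => ∃ (hP : P ∈ S) (hQ : Q ∈ S), R ⟨P, hP⟩ ⟨Q, hQ⟩

/-- A function on relations on all processes, restricted to relations on `S`:
`R ↦ f(R) ∩ (S × S)`. -/
def restrict (S : Set Proc) (f : BinRel Proc → BinRel Proc) : BinRel S → BinRel S :=
  fun R P Q => f (extend S R) P Q

/-! ## Weak bisimulation and expansion

Bound names of labels are fresh for both processes of a pair; for the process that moves first
this is built into the transition rules. -/

/-- Weak simulation function. -/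
def ws (R : BinRel Proc) : BinRel Proc := fun P Q =>
  ∀ (μ : Label) (P' : Proc), Disjoint μ.bn Q.fn → Step P μ P' →
    ∃ Q', WStepHat Q μ Q' ∧ R P' Q'

/-- Simulation function where a silent transition is matched by at most one silent transition. -/
def sHat (R : BinRel Proc) : BinRel Proc := fun P Q =>
  ∀ (μ : Label) (P' : Proc), Disjoint μ.bn Q.fn → Step P μ P' →
    ∃ Q', StepHat Q μ Q' ∧ R P' Q'

/-- Weak bisimulation function. -/
def wb (R : BinRel Proc) : BinRel Proc := fun P Q => ws R P Q ∧ ws (flip R) Q P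

/-- `R ↦ R ∩ wb(R)` -/
def wbBar : BinRel Proc → BinRel Proc := id ⊓ wb

/-- Expansion `P ≳ Q` (`Q` does at most as many silent transitions as `P`): the largest relation
`R` such that `R P Q` implies that `Q` matches transitions of `P` with at most one silent
transition for a silent one, and that `P` matches transitions of `Q` weakly. -/
def Expands (P Q : Proc) : Prop :=
  ∃ R : BinRel Proc, (∀ P Q, R P Q → sHat R P Q ∧ ws (flip R) Q P) ∧ R P Q

/-! ## Up-to techniques -/

/-- Up to expansion: `P ≳ R ≲ Q`. -/
def upExp (R : BinRel Proc) : BinRel Proc := fun P Q =>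
  ∃ P₀ Q₀, Expands P P₀ ∧ R P₀ Q₀ ∧ Expands Q Q₀

def upRefl (_ : BinRel Proc) : BinRel Proc := fun P Q => P = Q

def upSub (R : BinRel Proc) : BinRel Proc := fun P Q =>
  ∃ (σ : Name → Name) (P₀ Q₀ : Proc), R P₀ Q₀ ∧ P = P₀.subst σ ∧ Q = Q₀.subst σ

def upRes (R : BinRel Proc) : BinRel Proc := fun P Q =>
  ∃ (as : List Name) (P₀ Q₀ : Proc), R P₀ Q₀ ∧ P = nus as P₀ ∧ Q = nus as Q₀

def upPcomp (R : BinRel Proc) : BinRel Proc := fun P Q =>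
  ∃ P₁ Q₁ P₂ Q₂ : Proc, R P₁ Q₁ ∧ R P₂ Q₂ ∧ P = .par P₁ P₂ ∧ Q = .par Q₁ Q₂

def upTau (R : BinRel Proc) : BinRel Proc := fun P Q =>
  ∃ P₀ Q₀ : Proc, R P₀ Q₀ ∧ P = .ofGuard (.tau P₀) ∧ Q = .ofGuard (.tau Q₀)

def upOut (R : BinRel Proc) : BinRel Proc := fun P Q =>
  ∃ (a b : Name) (P₀ Q₀ : Proc),
    R P₀ Q₀ ∧ P = .ofGuard (outP a b P₀) ∧ Q = .ofGuard (outP a b Q₀)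

def upInp (R : BinRel Proc) : BinRel Proc := fun P Q =>
  ∃ (a b : Name) (P₀ Q₀ : Proc),
    R P₀ Q₀ ∧ P = .ofGuard (inpP a b P₀) ∧ Q = .ofGuard (inpP a b Q₀)

def upRep (R : BinRel Proc) : BinRel Proc := fun P Q =>
  ∃ G H : Guard, R (.ofGuard G) (.ofGuard H) ∧ P = .rep G ∧ Q = .rep H

/-- Finite sums `∑ Gᵢ` and `∑ Gᵢ'` (bracketed in the same way) such that every `(Gᵢ, Gᵢ')` is in
`(tau ∪ out ∪ inp ∪ refl)(R)`. The empty sum `0` is an instance of `refl`. -/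
inductive SumG (R : BinRel Proc) : Guard → Guard → Prop
  | summand {G G' : Guard} :
      (upTau ⊔ upOut ⊔ upInp ⊔ upRefl) R (.ofGuard G) (.ofGuard G') → SumG R G G'
  | plus {G G' H H' : Guard} : SumG R G G' → SumG R H H' → SumG R (.plus G H) (.plus G' H')

def upSumG (R : BinRel Proc) : BinRel Proc := fun P Q =>
  ∃ G G' : Guard, SumG R G G' ∧ P = .ofGuard G ∧ Q = .ofGuard G'

end PiCalc

namespace PiCalc

/-! ## Renaming and free names -/

/-! The witness for soundness is `symmClosure`: the closure, under all the techniques at once, of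
the relation together with its converse. The finite iterates of the up-to function lie inside it
(`omegaIter_le_symmClosure`), so the hypothesis says that the generating pairs are weakly simulated
into the closure. It remains to propagate this to every pair of the closure; since the closure is
symmetric, simulation is then bisimulation.

The propagation takes two inductions. `Closure.visibleSim` treats visible transitions and never
needs the silent ones: a visible transition of a compound process comes from a visible transition of
a component, and under expansion `P ≳ P₀` a visible transition of `P` is answered by exactly one
transition of `P₀`, with no silent steps before it. `Closure.silentSim` then treats silent
transitions, using the visible result for communications.

The difficult case is a renaming `σ` that is not injective, because `Pσ` can perform communications
that `P` cannot. `Step.substInv` shows that such a communication comes from an output of `P`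
followed by an input of the same object, on two distinct channels that `σ` identifies. Applying
visible simulation twice makes `Q` match both actions weakly, and weak aliased communication turns
this into silent transitions of `Qσ`. The second application concerns derivatives, not a premise of
the induction; this is why visible simulation is established for the whole closure beforehand.
Aliased communication is available only in `S`, so the closure admits arbitrary renamings for
processes of `S` alone, and closure under transitions keeps derivatives there. Permutations create
no aliases and are admitted everywhere, which pays for all changes of fresh names.

Structural congruence is a strong bisimulation (`StructCong.strongSim`), hence contained in
expansion, so discrepancies up to `≡` are absorbed by the closure. This also handles replication: by
`Step.rep_inv`, a transition of `!G` involves one or two copies of `G`, up to `≡`. -/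

theorem Nm.lift_weaken {n m : ℕ} (f : Nm n → Nm m) (x : Nm n) :
    Nm.lift f x.weaken = (f x).weaken := by
  cases x <;> rfl

theorem Nm.lift_comp {n m l : ℕ} (g : Nm m → Nm l) (f : Nm n → Nm m) :
    Nm.lift (g ∘ f) = Nm.lift g ∘ Nm.lift f := by
  funext x
  cases x with
  | free a => exact (Nm.lift_weaken g _).symm
  | bound i =>
    refine Fin.cases rfl (fun j => ?_) i
    exact (Nm.lift_weaken g _).symm

theorem Nm.fn_weaken {n : ℕ} (x : Nm n) : x.weaken.fn = x.fn := by
  cases x <;> rfl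

theorem Tm.map_map {k : Kind} {n m l : ℕ} (g : Nm m → Nm l) (f : Nm n → Nm m) (P : Tm k n) :
    (P.map f).map g = P.map (g ∘ f) := by
  induction P generalizing m l <;> simp_all [Tm.map, Nm.lift_comp]

theorem Tm.map_congr {k : Kind} {n m : ℕ} {f g : Nm n → Nm m} {P : Tm k n}
    (hf : ∀ a ∈ P.fn, f (.free a) = g (.free a)) (hb : ∀ i, f (.bound i) = g (.bound i)) :
    P.map f = P.map g := by
  have key : ∀ {n m : ℕ} {f g : Nm n → Nm m} (x : Nm n),
      (∀ a ∈ x.fn, f (.free a) = g (.free a)) → (∀ i, f (.bound i) = g (.bound i)) →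
      f x = g x := by
    intro n m f g x h h'
    cases x with
    | free a => exact h a (by simp [Nm.fn])
    | bound i => exact h' i
  have lift : ∀ {n m : ℕ} {f g : Nm n → Nm m} (A : Finset Name),
      (∀ a ∈ A, f (.free a) = g (.free a)) → (∀ i, f (.bound i) = g (.bound i)) →
      (∀ a ∈ A, Nm.lift f (.free a) = Nm.lift g (.free a)) ∧
        ∀ i, Nm.lift f (.bound i) = Nm.lift g (.bound i) := by
    intro n m f g A h h'
    refine ⟨fun a ha => by simp [Nm.lift, h a ha], fun i => ?_⟩
    refine Fin.cases rfl (fun j => ?_) i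
    simp [Nm.lift, h' j]
  induction P generalizing m with
  | nil => rfl
  | out a b P ih =>
    simp only [Tm.fn, Finset.mem_union] at hf
    simp only [Tm.map]
    rw [key a (fun x hx => hf x (by simp [hx])) hb, key b (fun x hx => hf x (by simp [hx])) hb,
      ih (fun x hx => hf x (by simp [hx])) hb]
  | inp a P ih =>
    simp only [Tm.fn, Finset.mem_union] at hf
    simp only [Tm.map]
    obtain ⟨h₁, h₂⟩ := lift P.fn (fun x hx => hf x (by simp [hx])) hb
    rw [key a (fun x hx => hf x (by simp [hx])) hb, ih h₁ h₂]
  | tau P ih => simp only [Tm.map, ih hf hb]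
  | plus G H ih₁ ih₂ =>
    simp only [Tm.fn, Finset.mem_union] at hf
    simp only [Tm.map]
    rw [ih₁ (fun x hx => hf x (by simp [hx])) hb, ih₂ (fun x hx => hf x (by simp [hx])) hb]
  | rep G ih => simp only [Tm.map, ih hf hb]
  | par P Q ih₁ ih₂ =>
    simp only [Tm.fn, Finset.mem_union] at hf
    simp only [Tm.map]
    rw [ih₁ (fun x hx => hf x (by simp [hx])) hb, ih₂ (fun x hx => hf x (by simp [hx])) hb]
  | res P ih =>
    obtain ⟨h₁, h₂⟩ := lift P.fn hf hb
    simp only [Tm.map, ih h₁ h₂]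
  | ofGuard G ih => simp only [Tm.map, ih hf hb]

theorem Tm.map_id {k : Kind} {n : ℕ} (P : Tm k n) : P.map (fun x => x) = P := by
  have lift : ∀ n, Nm.lift (fun x : Nm n => x) = fun x => x := by
    intro n
    funext x
    cases x with
    | free a => rfl
    | bound i => exact Fin.cases rfl (fun j => rfl) i
  induction P <;> simp_all [Tm.map]

theorem Tm.mem_fn_map {k : Kind} {n m : ℕ} {f : Nm n → Nm m} {P : Tm k n} {x : Name}
    (hx : x ∈ (P.map f).fn) :
    (∃ a ∈ P.fn, x ∈ (f (.free a)).fn) ∨ ∃ i, x ∈ (f (.bound i)).fn := by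
  have key : ∀ {n m : ℕ} {f : Nm n → Nm m} (y : Nm n), x ∈ (f y).fn →
      (∃ a ∈ y.fn, x ∈ (f (.free a)).fn) ∨ ∃ i, x ∈ (f (.bound i)).fn := by
    intro n m f y h
    cases y with
    | free a => exact .inl ⟨a, by simp [Nm.fn], h⟩
    | bound i => exact .inr ⟨i, h⟩
  have lift : ∀ {n m : ℕ} {f : Nm n → Nm m} (A : Finset Name),
      ((∃ a ∈ A, x ∈ (Nm.lift f (.free a)).fn) ∨ ∃ i, x ∈ (Nm.lift f (.bound i)).fn) →
      (∃ a ∈ A, x ∈ (f (.free a)).fn) ∨ ∃ i, x ∈ (f (.bound i)).fn := by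
    rintro n m f A (⟨a, ha, h⟩ | ⟨i, h⟩)
    · exact .inl ⟨a, ha, by simpa [Nm.lift, Nm.fn_weaken] using h⟩
    · revert h
      refine Fin.cases (fun h => ?_) (fun j h => ?_) i
      · simp [Nm.lift, Nm.fn] at h
      · exact .inr ⟨j, by simpa [Nm.lift, Nm.fn_weaken] using h⟩
  have mono : ∀ {n m : ℕ} {f : Nm n → Nm m} {A B : Finset Name}, A ⊆ B →
      ((∃ a ∈ A, x ∈ (f (.free a)).fn) ∨ ∃ i, x ∈ (f (.bound i)).fn) →
      (∃ a ∈ B, x ∈ (f (.free a)).fn) ∨ ∃ i, x ∈ (f (.bound i)).fn := by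
    rintro n m f A B hAB (⟨a, ha, h⟩ | h)
    · exact .inl ⟨a, hAB ha, h⟩
    · exact .inr h
  induction P generalizing m with
  | nil => simp [Tm.map, Tm.fn] at hx
  | out a b P ih =>
    simp only [Tm.map, Tm.fn, Finset.mem_union] at hx ⊢
    rcases hx with (hx | hx) | hx
    · exact (key a hx).imp_left fun ⟨c, hc, h⟩ => ⟨c, by simp [hc], h⟩
    · exact (key b hx).imp_left fun ⟨c, hc, h⟩ => ⟨c, by simp [hc], h⟩
    · exact (ih hx).imp_left fun ⟨c, hc, h⟩ => ⟨c, by simp [hc], h⟩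
  | inp a P ih =>
    simp only [Tm.map, Tm.fn, Finset.mem_union] at hx ⊢
    rcases hx with hx | hx
    · exact (key a hx).imp_left fun ⟨c, hc, h⟩ => ⟨c, by simp [hc], h⟩
    · exact (lift _ (ih hx)).imp_left fun ⟨c, hc, h⟩ => ⟨c, by simp [hc], h⟩
  | tau P ih => exact ih hx
  | plus G H ih₁ ih₂ =>
    simp only [Tm.map, Tm.fn, Finset.mem_union] at hx ⊢
    rcases hx with hx | hx
    · exact (ih₁ hx).imp_left fun ⟨c, hc, h⟩ => ⟨c, by simp [hc], h⟩
    · exact (ih₂ hx).imp_left fun ⟨c, hc, h⟩ => ⟨c, by simp [hc], h⟩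
  | rep G ih => exact ih hx
  | par P Q ih₁ ih₂ =>
    simp only [Tm.map, Tm.fn, Finset.mem_union] at hx ⊢
    rcases hx with hx | hx
    · exact (ih₁ hx).imp_left fun ⟨c, hc, h⟩ => ⟨c, by simp [hc], h⟩
    · exact (ih₂ hx).imp_left fun ⟨c, hc, h⟩ => ⟨c, by simp [hc], h⟩
  | res P ih => exact lift _ (ih hx)
  | ofGuard G ih => exact ih hx

theorem Tm.fn_subset_map {k : Kind} {n m : ℕ} {f : Nm n → Nm m} {P : Tm k n} {a : Name}
    (ha : a ∈ P.fn) : (f (.free a)).fn ⊆ (P.map f).fn := by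
  have key : ∀ {n m : ℕ} {f : Nm n → Nm m} {x : Nm n}, a ∈ x.fn →
      (f (.free a)).fn ⊆ (f x).fn := by
    intro n m f x h
    cases x with
    | free b => simp only [Nm.fn, Finset.mem_singleton] at h; subst h; rfl
    | bound i => simp [Nm.fn] at h
  have lift : ∀ {n m : ℕ} {f : Nm n → Nm m}, (Nm.lift f (.free a)).fn = (f (.free a)).fn :=
    fun {n m f} => Nm.fn_weaken _
  induction P generalizing m with
  | nil => simp [Tm.fn] at ha
  | out b c P ih =>
    simp only [Tm.map, Tm.fn, Finset.mem_union] at ha ⊢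
    rcases ha with (ha | ha) | ha
    · exact (key ha).trans (Finset.subset_union_left.trans Finset.subset_union_left)
    · exact (key ha).trans (Finset.subset_union_right.trans Finset.subset_union_left)
    · exact (ih ha).trans Finset.subset_union_right
  | inp b P ih =>
    simp only [Tm.map, Tm.fn, Finset.mem_union] at ha ⊢
    rcases ha with ha | ha
    · exact (key ha).trans Finset.subset_union_left
    · exact (lift.symm.subset.trans (ih ha)).trans Finset.subset_union_right
  | tau P ih => exact ih ha
  | plus G H ih₁ ih₂ =>
    simp only [Tm.map, Tm.fn, Finset.mem_union] at ha ⊢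
    rcases ha with ha | ha
    · exact (ih₁ ha).trans Finset.subset_union_left
    · exact (ih₂ ha).trans Finset.subset_union_right
  | rep G ih => exact ih ha
  | par P Q ih₁ ih₂ =>
    simp only [Tm.map, Tm.fn, Finset.mem_union] at ha ⊢
    rcases ha with ha | ha
    · exact (ih₁ ha).trans Finset.subset_union_left
    · exact (ih₂ ha).trans Finset.subset_union_right
  | res P ih => exact lift.symm.subset.trans (ih ha)
  | ofGuard G ih => exact ih ha

theorem Tm.mem_fn_subst {k : Kind} {n : ℕ} {σ : Name → Name} {P : Tm k n} {x : Name} :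
    x ∈ (P.subst σ).fn ↔ ∃ a ∈ P.fn, σ a = x := by
  constructor
  · intro h
    rcases Tm.mem_fn_map h with ⟨a, ha, h⟩ | ⟨i, h⟩
    · exact ⟨a, ha, by simpa [Nm.fn, eq_comm] using h⟩
    · simp [Nm.fn] at h
  · rintro ⟨a, ha, rfl⟩
    exact Tm.fn_subset_map ha (by simp [Nm.fn])

theorem Tm.fn_subset_inst {k : Kind} (b : Name) (P : Tm k 1) : P.fn ⊆ (P.inst b).fn :=
  fun _ ha => Tm.fn_subset_map ha (by simp [Nm.fn])

theorem Tm.mem_fn_inst {k : Kind} {b : Name} {P : Tm k 1} {x : Name} (hx : x ∈ (P.inst b).fn) :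
    x ∈ P.fn ∨ x = b := by
  rcases Tm.mem_fn_map hx with ⟨a, ha, h⟩ | ⟨i, h⟩
  · simp only [Nm.fn, Finset.mem_singleton] at h
    exact .inl (h ▸ ha)
  · exact .inr (by simpa [Nm.fn] using h)

theorem Tm.mem_fn_close {k : Kind} {b : Name} {P : Tm k 0} {x : Name} :
    x ∈ (P.close b).fn ↔ x ∈ P.fn ∧ x ≠ b := by
  constructor
  · intro h
    rcases Tm.mem_fn_map h with ⟨a, ha, h⟩ | ⟨i, h⟩
    · by_cases hab : a = b
      · simp [hab, Nm.fn] at h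
      · simp only [hab, if_false, Nm.fn, Finset.mem_singleton] at h
        exact h ▸ ⟨ha, hab⟩
    · exact i.elim0
  · rintro ⟨h, hb⟩
    exact Tm.fn_subset_map h (by simp [Nm.fn, hb])

theorem mem_fn_nu {b : Name} {P : Proc} {x : Name} : x ∈ (nu b P).fn ↔ x ∈ P.fn ∧ x ≠ b :=
  Tm.mem_fn_close

theorem Tm.subst_congr {k : Kind} {n : ℕ} {σ τ : Name → Name} {P : Tm k n}
    (h : ∀ a ∈ P.fn, σ a = τ a) : P.subst σ = P.subst τ :=
  Tm.map_congr (fun a ha => by simp [h a ha]) (fun _ => rfl)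

theorem Tm.subst_subst {k : Kind} {n : ℕ} (σ τ : Name → Name) (P : Tm k n) :
    (P.subst σ).subst τ = P.subst (τ ∘ σ) := by
  unfold Tm.subst
  rw [Tm.map_map]
  exact Tm.map_congr (fun a _ => rfl) (fun _ => rfl)

theorem Tm.subst_id {k : Kind} {n : ℕ} (P : Tm k n) : P.subst id = P := by
  conv_rhs => rw [← Tm.map_id P]
  exact Tm.map_congr (fun a _ => rfl) (fun _ => rfl)

theorem Tm.subst_eq_self {k : Kind} {n : ℕ} {σ : Name → Name} {P : Tm k n}
    (h : ∀ a ∈ P.fn, σ a = a) : P.subst σ = P :=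
  (Tm.subst_congr (τ := id) h).trans P.subst_id

theorem Tm.inst_subst {k : Kind} (b : Name) (σ : Name → Name) (P : Tm k 1) :
    (P.inst b).subst σ = (P.subst σ).inst (σ b) := by
  unfold Tm.subst Tm.inst
  rw [Tm.map_map, Tm.map_map]
  exact Tm.map_congr (fun a _ => rfl) (fun _ => rfl)

/-- The hypothesis is capture avoidance: only the bound name may be sent to `c`. The value `σ b`
plays no role, since `b` is no longer free after binding; hence the update. -/
theorem Tm.close_subst {k : Kind} {b c : Name} {σ : Name → Name} {P : Tm k 0}
    (h : ∀ x ∈ P.fn, x ≠ b → σ x ≠ c) :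
    (P.close b).subst σ = (P.subst (Function.update σ b c)).close c := by
  unfold Tm.subst Tm.close
  rw [Tm.map_map, Tm.map_map]
  refine Tm.map_congr (fun a ha => ?_) (fun i => i.elim0)
  by_cases hab : a = b
  · subst hab; simp
  · simp [hab, h a ha hab]

theorem Tm.close_inst {k : Kind} (b c : Name) (P : Tm k 0) :
    (P.close b).inst c = P.subst (Function.update id b c) := by
  unfold Tm.subst Tm.close Tm.inst
  rw [Tm.map_map]
  refine Tm.map_congr (fun a ha => ?_) (fun i => i.elim0)
  by_cases hab : a = b
  · subst hab; simp
  · simp [hab]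

theorem Tm.close_inst_self {k : Kind} (b : Name) (P : Tm k 0) : (P.close b).inst b = P := by
  rw [Tm.close_inst]
  exact Tm.subst_eq_self fun a _ => by by_cases h : a = b <;> simp [h]

theorem Tm.inst_close {k : Kind} {b : Name} {P : Tm k 1} (hb : b ∉ P.fn) :
    (P.inst b).close b = P := by
  conv_rhs => rw [← Tm.map_id P]
  unfold Tm.close Tm.inst
  rw [Tm.map_map]
  refine Tm.map_congr (fun a ha => ?_) (fun i => ?_)
  · have : a ≠ b := fun h => hb (h ▸ ha)
    simp [this]
  · simp [Subsingleton.elim i 0]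

theorem nu_inst {b : Name} {P : Tm .proc 1} (hb : b ∉ P.fn) : nu b (P.inst b) = .res P := by
  rw [nu, Tm.inst_close hb]

theorem subst_res {n : ℕ} (σ : Name → Name) (P : Tm .proc (n + 1)) :
    (Tm.res P).subst σ = .res (P.subst σ) :=
  congrArg Tm.res (Tm.map_congr (fun _ _ => rfl) fun i => Fin.cases rfl (fun _ => rfl) i)

theorem subst_inp {n : ℕ} (σ : Name → Name) (a : Name) (P : Tm .proc (n + 1)) :
    (Tm.inp (.free a) P).subst σ = .inp (.free (σ a)) (P.subst σ) :=
  congrArg (Tm.inp (.free (σ a)))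
    (Tm.map_congr (fun _ _ => rfl) fun i => Fin.cases rfl (fun _ => rfl) i)

theorem nu_subst {b c : Name} {σ : Name → Name} {P : Proc}
    (h : ∀ x ∈ P.fn, x ≠ b → σ x ≠ c) :
    (nu b P).subst σ = nu c (P.subst (Function.update σ b c)) :=
  (subst_res _ _).trans (congrArg Tm.res (Tm.close_subst (P := P) h))

theorem inpP_subst {a b c : Name} {σ : Name → Name} {P : Proc}
    (h : ∀ x ∈ P.fn, x ≠ b → σ x ≠ c) :
    (inpP a b P).subst σ = inpP (σ a) c (P.subst (Function.update σ b c)) :=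
  (subst_inp _ _ _).trans (congrArg (Tm.inp (.free (σ a))) (Tm.close_subst (P := P) h))

/-- Replacing a name by a fresh one can be done by a transposition. Being injective, transpositions
preserve transitions without side conditions (`Step.perm`). -/
theorem Tm.subst_swap {k : Kind} {n : ℕ} {a b : Name} {P : Tm k n} (hb : b ∉ P.fn) :
    P.subst (Equiv.swap a b) = P.subst (Function.update id a b) := by
  refine Tm.subst_congr fun x hx => ?_
  have hxb : x ≠ b := fun h => hb (h ▸ hx)
  by_cases hxa : x = a
  · subst hxa; simp
  · simp [hxa, Equiv.swap_apply_of_ne_of_ne hxa hxb]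

/-- This is α-conversion of a restriction in terms of names, the form used whenever a bound name has
to avoid a finite set. -/
theorem nu_swap {a b : Name} {P : Proc} (hb : b ∉ (nu a P).fn) :
    nu a P = nu b (P.subst (Equiv.swap a b)) := by
  by_cases hab : b = a
  · subst hab; simp [Tm.subst_id]
  · have hb' : b ∉ P.fn := fun h => hb (mem_fn_nu.2 ⟨h, hab⟩)
    rw [Tm.subst_swap hb', ← nu_subst, Tm.subst_id]
    exact fun x hx _ h => hb' (h ▸ hx)

theorem subst_perm_symm {k : Kind} {n : ℕ} (π : Equiv.Perm Name) (P : Tm k n) :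
    (P.subst π).subst π.symm = P := by
  rw [Tm.subst_subst]
  exact Tm.subst_eq_self fun a _ => by simp

theorem subst_symm_perm {k : Kind} {n : ℕ} (π : Equiv.Perm Name) (P : Tm k n) :
    (P.subst π.symm).subst π = P :=
  subst_perm_symm π.symm P

theorem nu_perm (π : Equiv.Perm Name) (a : Name) (P : Proc) :
    (nu a P).subst π = nu (π a) (P.subst π) := by
  rw [nu_subst (c := π a) (fun x _ h => by simpa using h)]
  simp

theorem update_of_notMem {σ : Name → Name} {A : Finset Name} {b c : Name} (hb : b ∉ A) :
    ∀ x ∈ A, Function.update σ b c x = σ x := by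
  intro x hx
  have : x ≠ b := by rintro rfl; exact hb hx
  exact Function.update_of_ne this _ _

theorem swap_of_notMem {A : Finset Name} {b c : Name} (hb : b ∉ A) (hc : c ∉ A) :
    ∀ x ∈ A, Equiv.swap b c x = x := by
  intro x hx
  refine Equiv.swap_apply_of_ne_of_ne ?_ ?_
  · rintro rfl; exact hb hx
  · rintro rfl; exact hc hx

theorem exists_fresh (A : Finset Name) : ∃ b : Name, b ∉ A := Infinite.exists_notMem_finset A

/-! ## Names and transitions -/

/-- Free names of a label that occur in every process performing it. -/
def Label.origin : Label → Finset Name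
  | .tau => ∅
  | .out a b => {a, b}
  | .bout a _ => {a}
  | .inp a _ => {a}

/-- Renaming of labels. -/
def Label.subst (σ : Name → Name) : Label → Label
  | .tau => .tau
  | .out a b => .out (σ a) (σ b)
  | .bout a b => .bout (σ a) (σ b)
  | .inp a b => .inp (σ a) (σ b)

theorem Label.bn_subset_names (μ : Label) : μ.bn ⊆ μ.names := by
  cases μ <;> simp [Label.bn, Label.names]

theorem Label.origin_subset_names (μ : Label) : μ.origin ⊆ μ.names := by
  cases μ <;> simp [Label.origin, Label.names]

theorem Label.subst_congr {σ τ : Name → Name} {μ : Label} (h : ∀ a ∈ μ.names, σ a = τ a) :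
    μ.subst σ = μ.subst τ := by
  cases μ <;> simp_all [Label.subst, Label.names]

theorem Label.mem_names_subst {σ : Name → Name} {μ : Label} {x : Name} :
    x ∈ (μ.subst σ).names ↔ ∃ a ∈ μ.names, σ a = x := by
  cases μ <;> simp [Label.subst, Label.names, eq_comm]

theorem Label.mem_bn_subst {σ : Name → Name} {μ : Label} {x : Name} :
    x ∈ (μ.subst σ).bn ↔ ∃ a ∈ μ.bn, σ a = x := by
  cases μ <;> simp [Label.subst, Label.bn, eq_comm]

theorem Label.subst_symm_perm (π : Equiv.Perm Name) (μ : Label) :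
    (μ.subst π.symm).subst π = μ := by
  cases μ <;> simp [Label.subst]

theorem fn_par {n : ℕ} (P Q : Tm .proc n) : (Tm.par P Q).fn = P.fn ∪ Q.fn := rfl

theorem Step.guard_bn {G : Guard} {μ : Label} {P' : Proc} (h : Step (.ofGuard G) μ P') :
    μ.bn = ∅ := by
  generalize hP : Tm.ofGuard G = P at h
  induction h generalizing G with
  | sumL _ ih | sumR _ ih => exact ih rfl
  | _ => first | rfl | cases hP

/-- The three facts go in one induction because they depend on each other: after a communication,
for instance, the object received on one side is accounted for by the origin of the output on the
other. -/
theorem Step.fn_facts {P : Proc} {μ : Label} {P' : Proc} (h : Step P μ P') :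
    (∀ x ∈ P'.fn, x ∈ P.fn ∨ x ∈ μ.names) ∧ (∀ x ∈ μ.origin, x ∈ P.fn) ∧
      ∀ x ∈ μ.bn, x ∉ P.fn := by
  induction h with
  | inp a c P =>
    refine ⟨fun x hx => ?_, ?_, by simp [Label.bn]⟩
    · rcases Tm.mem_fn_inst hx with h | h
      · exact .inl (by simp [Tm.fn, h])
      · exact .inr (by simp [Label.names, h])
    · simp [Label.origin, Tm.fn, Nm.fn]
  | out a b P => simp +contextual [Label.origin, Label.bn, Tm.fn, Nm.fn]
  | tau P => exact ⟨fun x hx => .inl hx, by simp [Label.origin], by simp [Label.bn]⟩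
  | sumL h ih | sumR h ih =>
    rw [h.guard_bn] at ih ⊢
    simp only [Tm.fn, Finset.mem_union] at *
    grind
  | rep _ ih => simpa [Tm.fn] using ih
  | @opn P a b P' hb hba _ ih =>
    obtain ⟨h₁, h₂, -⟩ := ih
    refine ⟨fun x hx => ?_, fun x hx => ?_, fun x hx => ?_⟩
    · rcases h₁ x hx with h | h
      · rcases Tm.mem_fn_inst h with h | h
        · exact .inl h
        · exact .inr (by simp [Label.names, h])
      · exact .inr h
    · have hx' : x = a := by simpa [Label.origin] using hx
      subst hx'
      exact (Tm.mem_fn_inst (h₂ x (by simp [Label.origin]))).resolve_right hba.symm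
    · have hx' : x = b := by simpa [Label.bn] using hx
      subst hx'; exact hb
  | @res P b μ P' hb hμ _ ih =>
    obtain ⟨h₁, h₂, h₃⟩ := ih
    refine ⟨fun x hx => ?_, fun x hx => ?_, fun x hx h => ?_⟩
    · obtain ⟨hx, hxb⟩ := mem_fn_nu.1 hx
      rcases h₁ x hx with h | h
      · exact .inl ((Tm.mem_fn_inst h).resolve_right hxb)
      · exact .inr h
    · exact (Tm.mem_fn_inst (h₂ x hx)).resolve_right
        fun h => hμ (h ▸ Label.origin_subset_names _ hx)
    · exact h₃ x hx (Tm.fn_subset_inst _ _ h)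
  | parL hd _ ih =>
    simp only [fn_par, Finset.mem_union, Finset.disjoint_left] at *
    grind
  | parR hd _ ih =>
    simp only [fn_par, Finset.mem_union, Finset.disjoint_left] at *
    grind
  | commL _ _ ih₁ ih₂ =>
    simp [fn_par, Label.names, Label.origin, Label.bn] at *
    grind
  | commR _ _ ih₁ ih₂ =>
    simp [fn_par, Label.names, Label.origin, Label.bn] at *
    grind
  | closeL _ _ _ ih₁ ih₂ =>
    simp [mem_fn_nu, fn_par, Label.names, Label.origin, Label.bn] at *
    grind
  | closeR _ _ _ ih₁ ih₂ =>
    simp [mem_fn_nu, fn_par, Label.names, Label.origin, Label.bn] at *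
    grind

theorem Step.mem_fn {P P' : Proc} {μ : Label} (h : Step P μ P') {x : Name} (hx : x ∈ P'.fn) :
    x ∈ P.fn ∨ x ∈ μ.names :=
  h.fn_facts.1 x hx

theorem Step.origin_mem {P P' : Proc} {μ : Label} (h : Step P μ P') {x : Name}
    (hx : x ∈ μ.origin) : x ∈ P.fn :=
  h.fn_facts.2.1 x hx

theorem Step.bn_notMem {P P' : Proc} {μ : Label} (h : Step P μ P') {x : Name}
    (hx : x ∈ μ.bn) : x ∉ P.fn :=
  h.fn_facts.2.2 x hx

theorem Step.fn_tau {P P' : Proc} (h : Step P .tau P') : P'.fn ⊆ P.fn :=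
  fun _ hx => (h.mem_fn hx).resolve_right (by simp [Label.names])

theorem Step.inp_mem {P P' : Proc} {a b : Name} (h : Step P (.inp a b) P') : a ∈ P.fn :=
  h.origin_mem (by simp [Label.origin])

theorem Step.out_mem {P P' : Proc} {a b : Name} (h : Step P (.out a b) P') :
    a ∈ P.fn ∧ b ∈ P.fn :=
  ⟨h.origin_mem (by simp [Label.origin]), h.origin_mem (by simp [Label.origin])⟩

theorem Step.bout_mem {P P' : Proc} {a b : Name} (h : Step P (.bout a b) P') :
    a ∈ P.fn ∧ b ∉ P.fn :=
  ⟨h.origin_mem (by simp [Label.origin]), h.bn_notMem (by simp [Label.bn])⟩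

theorem Tm.subst_update {k : Kind} {n : ℕ} {P : Tm k n} {σ : Name → Name} {b c : Name}
    (hb : b ∉ P.fn) : P.subst (Function.update σ b c) = P.subst σ :=
  Tm.subst_congr (update_of_notMem hb)

theorem Label.subst_update {μ : Label} {σ : Name → Name} {b c : Name}
    (hb : b ∉ μ.names) : μ.subst (Function.update σ b c) = μ.subst σ :=
  Label.subst_congr (update_of_notMem hb)

/-- Renaming can only add behaviour, as long as it does not identify an extruded name with a free
name. Names bound inside the derivation (restricted ones, or those extruded in a `close` rule) are
redirected to fresh names by updating `σ`, which explains the induction over all `σ`. -/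
theorem Step.subst {P : Proc} {μ : Label} {P' : Proc} (h : Step P μ P') (σ : Name → Name)
    (hσ : ∀ b ∈ μ.bn, ∀ x ∈ P.fn, σ x ≠ σ b) : Step (P.subst σ) (μ.subst σ) (P'.subst σ) := by
  induction h generalizing σ with
  | inp a c P =>
    rw [Tm.inst_subst]
    change Step (.ofGuard ((Tm.inp (.free a) P).subst σ)) _ _
    rw [subst_inp]
    exact .inp _ _ _
  | out a b P => exact .out _ _ _
  | tau P => exact .tau _
  | sumL _ ih => exact .sumL (ih σ fun b hb x hx => hσ b hb x (Finset.mem_union_left _ hx))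
  | sumR _ ih => exact .sumR (ih σ fun b hb x hx => hσ b hb x (Finset.mem_union_right _ hx))
  | rep _ ih =>
    exact .rep (ih σ fun b hb x hx => hσ b hb x (by simpa [Tm.fn] using hx))
  | @opn P a b P' hb hba h ih =>
    rw [subst_res]
    have ha : a ∈ P.fn := (Tm.mem_fn_inst h.out_mem.1).resolve_right hba.symm
    have hσ' : ∀ x ∈ P.fn, σ x ≠ σ b := hσ b (by simp [Label.bn])
    refine .opn (fun h => ?_) (hσ' a ha).symm ?_
    · obtain ⟨x, hx, h⟩ := Tm.mem_fn_subst.1 h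
      exact hσ' x hx h
    · rw [← Tm.inst_subst]
      exact ih σ (by simp [Label.bn])
  | @res P b μ P' hb hμ h ih =>
    -- The value `σ b` may clash with images of other names, so the restricted name `b` is sent to a
    -- fresh `c` instead.
    obtain ⟨c, hc⟩ := exists_fresh (P.fn.image σ ∪ μ.names.image σ)
    simp only [Finset.mem_union, Finset.mem_image, not_or, not_exists, not_and] at hc
    obtain ⟨hc₁, hc₂⟩ := hc
    have hP : ∀ x ∈ P'.fn, x ≠ b → σ x ≠ c := fun x hx hxb => by
      rcases h.mem_fn hx with hx | hx
      · exact hc₁ x ((Tm.mem_fn_inst hx).resolve_right hxb)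
      · exact hc₂ x hx
    rw [subst_res, nu_subst hP]
    have key := ih (Function.update σ b c) fun d hd x hx => by
      have hdb : d ≠ b := fun h => hμ (h ▸ Label.bn_subset_names _ hd)
      rw [Function.update_of_ne hdb]
      by_cases hxb : x = b
      · subst hxb
        rw [Function.update_self]
        exact fun h => hc₂ d (Label.bn_subset_names _ hd) h.symm
      · rw [Function.update_of_ne hxb]
        exact hσ d hd x ((Tm.mem_fn_inst hx).resolve_right hxb)
    rw [Label.subst_update hμ, Tm.inst_subst, Tm.subst_update hb, Function.update_self] at key
    refine .res (fun h => ?_) (fun h => ?_) key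
    · obtain ⟨x, hx, h⟩ := Tm.mem_fn_subst.1 h
      exact hc₁ x hx h
    · obtain ⟨x, hx, h⟩ := Label.mem_names_subst.1 h
      exact hc₂ x hx h
  | @parL P Q P' μ hd _ ih =>
    refine .parL (Finset.disjoint_left.2 fun x hx hx' => ?_)
      (ih σ fun b hb x hx => hσ b hb x (Finset.mem_union_left _ hx))
    obtain ⟨b, hb, rfl⟩ := Label.mem_bn_subst.1 hx
    obtain ⟨y, hy, h⟩ := Tm.mem_fn_subst.1 hx'
    exact hσ b hb y (Finset.mem_union_right _ hy) h
  | @parR P Q Q' μ hd _ ih =>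
    refine .parR (Finset.disjoint_left.2 fun x hx hx' => ?_)
      (ih σ fun b hb x hx => hσ b hb x (Finset.mem_union_right _ hx))
    obtain ⟨b, hb, rfl⟩ := Label.mem_bn_subst.1 hx
    obtain ⟨y, hy, h⟩ := Tm.mem_fn_subst.1 hx'
    exact hσ b hb y (Finset.mem_union_left _ hy) h
  | commL _ _ ih₁ ih₂ =>
    exact .commL (ih₁ σ (by simp [Label.bn])) (ih₂ σ (by simp [Label.bn]))
  | commR _ _ ih₁ ih₂ =>
    exact .commR (ih₁ σ (by simp [Label.bn])) (ih₂ σ (by simp [Label.bn]))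
  | @closeL P Q P' Q' a b hb h₁ h₂ ih₁ ih₂ =>
    obtain ⟨c, hc⟩ := exists_fresh (P.fn.image σ ∪ Q.fn.image σ)
    simp only [Finset.mem_union, Finset.mem_image, not_or, not_exists, not_and] at hc
    obtain ⟨hc₁, hc₂⟩ := hc
    have hbQ := h₂.bout_mem.2
    have hf : ∀ x ∈ (Tm.par P' Q').fn, x ≠ b → σ x ≠ c := fun x hx hxb => by
      rcases Finset.mem_union.1 hx with hx | hx
      · refine hc₁ x ((h₁.mem_fn hx).elim id fun h => ?_)
        have : x = a := by simpa [Label.names, hxb] using h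
        exact this ▸ h₁.inp_mem
      · refine hc₂ x ((h₂.mem_fn hx).elim id fun h => ?_)
        have : x = a := by simpa [Label.names, hxb] using h
        exact this ▸ h₂.bout_mem.1
    rw [nu_subst hf]
    have k₁ := ih₁ (Function.update σ b c) (by simp [Label.bn])
    have k₂ := ih₂ (Function.update σ b c) fun d hd x hx => by
      have hd' : d = b := by simpa [Label.bn] using hd
      subst hd'
      rw [Function.update_self, update_of_notMem hbQ x hx]
      exact hc₂ x hx
    rw [Tm.subst_update hb] at k₁
    rw [Tm.subst_update hbQ] at k₂
    simp only [Label.subst, Function.update_self] at k₁ k₂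
    refine .closeL (fun h => ?_) k₁ k₂
    obtain ⟨x, hx, h⟩ := Tm.mem_fn_subst.1 h
    exact hc₁ x hx h
  | @closeR P Q P' Q' a b hb h₁ h₂ ih₁ ih₂ =>
    obtain ⟨c, hc⟩ := exists_fresh (P.fn.image σ ∪ Q.fn.image σ)
    simp only [Finset.mem_union, Finset.mem_image, not_or, not_exists, not_and] at hc
    obtain ⟨hc₁, hc₂⟩ := hc
    have hbP := h₁.bout_mem.2
    have hf : ∀ x ∈ (Tm.par P' Q').fn, x ≠ b → σ x ≠ c := fun x hx hxb => by
      rcases Finset.mem_union.1 hx with hx | hx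
      · refine hc₁ x ((h₁.mem_fn hx).elim id fun h => ?_)
        have : x = a := by simpa [Label.names, hxb] using h
        exact this ▸ h₁.bout_mem.1
      · refine hc₂ x ((h₂.mem_fn hx).elim id fun h => ?_)
        have : x = a := by simpa [Label.names, hxb] using h
        exact this ▸ h₂.inp_mem
    rw [nu_subst hf]
    have k₂ := ih₂ (Function.update σ b c) (by simp [Label.bn])
    have k₁ := ih₁ (Function.update σ b c) fun d hd x hx => by
      have hd' : d = b := by simpa [Label.bn] using hd
      subst hd'
      rw [Function.update_self, update_of_notMem hbP x hx]
      exact hc₁ x hx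
    rw [Tm.subst_update hbP] at k₁
    rw [Tm.subst_update hb] at k₂
    simp only [Label.subst, Function.update_self] at k₁ k₂
    refine .closeR (fun h => ?_) k₁ k₂
    obtain ⟨x, hx, h⟩ := Tm.mem_fn_subst.1 h
    exact hc₂ x hx h

theorem Step.perm {P : Proc} {μ : Label} {P' : Proc} (h : Step P μ P') (π : Equiv.Perm Name) :
    Step (P.subst π) (μ.subst π) (P'.subst π) :=
  h.subst π fun _ hb _ hx e => h.bn_notMem hb (π.injective e ▸ hx)

theorem Label.subst_swap {μ : Label} {b c : Name} (hb : b ∉ μ.names) (hc : c ∉ μ.names) :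
    μ.subst (Equiv.swap b c) = μ := by
  have : μ.subst (Equiv.swap b c) = μ.subst id := Label.subst_congr (swap_of_notMem hb hc)
  rw [this]
  cases μ <;> rfl

theorem Tm.subst_swap_eq_self {k : Kind} {n : ℕ} {P : Tm k n} {b c : Name} (hb : b ∉ P.fn)
    (hc : c ∉ P.fn) : P.subst (Equiv.swap b c) = P :=
  Tm.subst_eq_self (swap_of_notMem hb hc)

/-- The object of a bound output can be renamed. -/
theorem Step.bout_rename {P P' : Proc} {a b c : Name} (h : Step P (.bout a b) P')
    (hc : c ∉ P.fn) : Step P (.bout a c) (P'.subst (Equiv.swap b c)) := by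
  obtain ⟨ha, hb⟩ := h.bout_mem
  have key := h.perm (Equiv.swap b c)
  rwa [Tm.subst_swap_eq_self hb hc, Label.subst, Equiv.swap_apply_left,
    swap_of_notMem hb hc a ha] at key

/-- An input of a fresh name can be renamed. -/
theorem Step.inp_rename {P P' : Proc} {a b c : Name} (h : Step P (.inp a b) P')
    (hb : b ∉ P.fn) (hc : c ∉ P.fn) : Step P (.inp a c) (P'.subst (Equiv.swap b c)) := by
  have ha := h.inp_mem
  have key := h.perm (Equiv.swap b c)
  rwa [Tm.subst_swap_eq_self hb hc, Label.subst, Equiv.swap_apply_left,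
    swap_of_notMem hb hc a ha] at key

/-! ## Inversion with fresh names -/

theorem Step.nu {P P' : Proc} {μ : Label} {c : Name} (h : Step P μ P') (hc : c ∉ μ.names) :
    Step (nu c P) μ (nu c P') := by
  refine Step.res (b := c) (fun h => (Tm.mem_fn_close.1 h).2 rfl) hc ?_
  rw [Tm.close_inst_self]
  exact h

theorem Step.nu_open {P P' : Proc} {a c : Name} (h : Step P (.out a c) P') (hc : c ≠ a) :
    Step (PiCalc.nu c P) (.bout a c) P' := by
  refine Step.opn (fun h => (Tm.mem_fn_close.1 h).2 rfl) hc ?_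
  rw [Tm.close_inst_self]
  exact h

/-- The rule for restriction exhibits some fresh name; a transposition moves it to any prescribed
fresh `c`. -/
theorem Step.res_inv {P : Tm .proc 1} {μ : Label} {X : Proc} (h : Step (.res P) μ X) {c : Name}
    (hc : c ∉ P.fn) (hcμ : c ∉ μ.names) :
    (∃ a b, μ = .bout a b ∧ b ∉ P.fn ∧ b ≠ a ∧ Step (P.inst b) (.out a b) X) ∨
      ∃ P', Step (P.inst c) μ P' ∧ X = PiCalc.nu c P' := by
  cases h with
  | opn hb hba h => exact .inl ⟨_, _, rfl, hb, hba, h⟩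
  | @res _ b _ P' hb hbμ h =>
    refine .inr ⟨P'.subst (Equiv.swap b c), ?_, nu_swap fun h' => ?_⟩
    · have key := h.perm (Equiv.swap b c)
      rwa [Label.subst_swap hbμ hcμ, Tm.inst_subst, Tm.subst_swap_eq_self hb hc,
        Equiv.swap_apply_left] at key
    · obtain ⟨h₁, h₂⟩ := mem_fn_nu.1 h'
      exact (h.mem_fn h₁).elim (fun h => (Tm.mem_fn_inst h).elim hc h₂) hcμ

theorem Step.nu_inv {c : Name} {P : Proc} {μ : Label} {X : Proc} (h : Step (PiCalc.nu c P) μ X)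
    (hc : c ∉ μ.names) :
    (∃ a b, μ = .bout a b ∧ b ∉ (PiCalc.nu c P).fn ∧ b ≠ a ∧ b ≠ c ∧ b ∉ P.fn ∧
      Step (P.subst (Equiv.swap c b)) (.out a b) X) ∨
      ∃ P', Step P μ P' ∧ X = PiCalc.nu c P' := by
  rcases h.res_inv (c := c) (fun h => (Tm.mem_fn_close.1 h).2 rfl) hc with
    ⟨a, b, rfl, hb, hba, h'⟩ | ⟨P', h', rfl⟩
  · have hbc : b ≠ c := fun h => hc (by simp [Label.names, h])
    have hbP : b ∉ P.fn := fun h => hb (Tm.mem_fn_close.2 ⟨h, hbc⟩)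
    refine .inl ⟨a, b, rfl, hb, hba, hbc, hbP, ?_⟩
    rwa [Tm.close_inst, ← Tm.subst_swap hbP] at h'
  · refine .inr ⟨P', ?_, rfl⟩
    rwa [Tm.close_inst_self] at h'

/-- Transitions of a parallel composition, where extruded names are outside of `A`. -/
inductive ParStep (A : Finset Name) (P Q : Proc) : Label → Proc → Prop
  | parL {μ : Label} {P' : Proc} :
      Disjoint μ.bn Q.fn → Step P μ P' → ParStep A P Q μ (.par P' Q)
  | parR {μ : Label} {Q' : Proc} :
      Disjoint μ.bn P.fn → Step Q μ Q' → ParStep A P Q μ (.par P Q')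
  | commL {P' Q' : Proc} {a b : Name} :
      Step P (.inp a b) P' → Step Q (.out a b) Q' → ParStep A P Q .tau (.par P' Q')
  | commR {P' Q' : Proc} {a b : Name} :
      Step P (.out a b) P' → Step Q (.inp a b) Q' → ParStep A P Q .tau (.par P' Q')
  | closeL {P' Q' : Proc} {a b : Name} : b ∉ A → b ∉ P.fn → b ∉ Q.fn →
      Step P (.inp a b) P' → Step Q (.bout a b) Q' → ParStep A P Q .tau (nu b (.par P' Q'))
  | closeR {P' Q' : Proc} {a b : Name} : b ∉ A → b ∉ P.fn → b ∉ Q.fn →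
      Step P (.bout a b) P' → Step Q (.inp a b) Q' → ParStep A P Q .tau (nu b (.par P' Q'))

/-- In the two `close` rules the extruded name is bound in the result, so both premises can be
renamed to use a name outside `A`. Later arguments choose `A` so that the side conditions of the
rules they apply hold. -/
theorem Step.par_inv {P Q : Proc} {μ : Label} {X : Proc} (h : Step (.par P Q) μ X)
    (A : Finset Name) : ParStep A P Q μ X := by
  have fresh : ∀ {P Q P' Q' : Proc} {a b c : Name}, Step P (.inp a b) P' →
      Step Q (.bout a b) Q' → c ∉ P.fn → c ∉ Q.fn → c ∉ P'.fn ∪ Q'.fn ∨ c = b := by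
    intro P Q P' Q' a b c h₁ h₂ hcP hcQ
    by_cases hcb : c = b
    · exact .inr hcb
    have hca : c ≠ a := fun h => hcP (h ▸ h₁.inp_mem)
    refine .inl fun h => ?_
    rcases Finset.mem_union.1 h with h | h
    · rcases h₁.mem_fn h with h | h
      · exact hcP h
      · simp [Label.names, hca, hcb] at h
    · rcases h₂.mem_fn h with h | h
      · exact hcQ h
      · simp [Label.names, hca, hcb] at h
  cases h with
  | parL hd h => exact .parL hd h
  | parR hd h => exact .parR hd h
  | commL h₁ h₂ => exact .commL h₁ h₂
  | commR h₁ h₂ => exact .commR h₁ h₂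
  | @closeL _ _ P' Q' a b hb h₁ h₂ =>
    obtain ⟨c, hc⟩ := exists_fresh (A ∪ P.fn ∪ Q.fn)
    simp only [Finset.mem_union, not_or] at hc
    have hf : c ∉ (PiCalc.nu b (.par P' Q')).fn := fun h => by
      obtain ⟨h, hcb⟩ := mem_fn_nu.1 h
      exact (fresh h₁ h₂ hc.1.2 hc.2).elim (fun h' => h' h) hcb
    rw [nu_swap hf]
    exact .closeL hc.1.1 hc.1.2 hc.2 (h₁.inp_rename hb hc.1.2) (h₂.bout_rename hc.2)
  | @closeR _ _ P' Q' a b hb h₁ h₂ =>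
    obtain ⟨c, hc⟩ := exists_fresh (A ∪ P.fn ∪ Q.fn)
    simp only [Finset.mem_union, not_or] at hc
    have hf : c ∉ (PiCalc.nu b (.par P' Q')).fn := fun h => by
      obtain ⟨h, hcb⟩ := mem_fn_nu.1 h
      exact (fresh h₂ h₁ hc.2 hc.1.2).elim (fun h' => h' (Finset.union_comm P'.fn Q'.fn ▸ h)) hcb
    rw [nu_swap hf]
    exact .closeR hc.1.1 hc.1.2 hc.2 (h₁.bout_rename hc.1.2) (h₂.inp_rename hb hc.2)

/-! ## Structural congruence is a strong bisimulation -/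

/-- The point is that one body `R` serves both orders of restriction. With `σ = id` this is
simultaneous α-conversion of both sides of the commutation law. -/
theorem exists_nu_nu_subst {a b c d : Name} {σ : Name → Name} {P : Proc} (hab : a ≠ b)
    (hcd : c ≠ d) (hc : ∀ x ∈ P.fn, σ x ≠ c) (hd : ∀ x ∈ P.fn, σ x ≠ d) :
    ∃ R : Proc, (nu a (nu b P)).subst σ = nu c (nu d R) ∧
      (nu b (nu a P)).subst σ = nu d (nu c R) := by
  refine ⟨P.subst (Function.update (Function.update σ a c) b d), ?_, ?_⟩
  · rw [nu_subst (c := c) fun x hx _ => hc x (mem_fn_nu.1 hx).1, nu_subst (c := d)]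
    intro x hx _
    by_cases hxa : x = a
    · subst hxa; simpa using hcd
    · simpa [hxa] using hd x hx
  · rw [nu_subst (c := d) fun x hx _ => hd x (mem_fn_nu.1 hx).1, nu_subst (c := c),
      Function.update_comm hab]
    intro x hx _
    by_cases hxb : x = b
    · subst hxb; simpa using hcd.symm
    · simpa [hxb] using hc x hx

theorem StructCong.subst {k : Kind} {P Q : Tm k 0} (h : StructCong P Q) (σ : Name → Name) :
    StructCong (P.subst σ) (Q.subst σ) := by
  have fresh : ∀ {P Q : Proc}, ∃ c, (∀ x ∈ P.fn, σ x ≠ c) ∧ ∀ x ∈ Q.fn, σ x ≠ c := by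
    intro P Q
    obtain ⟨c, hc⟩ := exists_fresh (P.fn.image σ ∪ Q.fn.image σ)
    simp only [Finset.mem_union, Finset.mem_image, not_or, not_exists, not_and] at hc
    exact ⟨c, hc.1, hc.2⟩
  induction h generalizing σ with
  | refl P => exact .refl _
  | symm _ ih => exact .symm (ih σ fresh)
  | trans _ _ ih₁ ih₂ => exact .trans (ih₁ σ fresh) (ih₂ σ fresh)
  | out a b _ ih => exact .out _ _ (ih σ fresh)
  | @inp a b P Q _ ih =>
    obtain ⟨c, hP, hQ⟩ := @fresh P Q
    rw [inpP_subst fun x hx _ => hP x hx, inpP_subst fun x hx _ => hQ x hx]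
    refine .inp _ _ (ih _ fun {P Q} => ?_)
    obtain ⟨e, he⟩ := exists_fresh (P.fn.image (Function.update σ b c) ∪
      Q.fn.image (Function.update σ b c))
    simp only [Finset.mem_union, Finset.mem_image, not_or, not_exists, not_and] at he
    exact ⟨e, he.1, he.2⟩
  | tau _ ih => exact .tau (ih σ fresh)
  | plus _ _ ih₁ ih₂ => exact .plus (ih₁ σ fresh) (ih₂ σ fresh)
  | rep _ ih => exact .rep (ih σ fresh)
  | par _ _ ih₁ ih₂ => exact .par (ih₁ σ fresh) (ih₂ σ fresh)
  | @nu b P Q _ ih =>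
    obtain ⟨c, hP, hQ⟩ := @fresh P Q
    rw [nu_subst fun x hx _ => hP x hx, nu_subst fun x hx _ => hQ x hx]
    refine .nu _ (ih _ fun {P Q} => ?_)
    obtain ⟨e, he⟩ := exists_fresh (P.fn.image (Function.update σ b c) ∪
      Q.fn.image (Function.update σ b c))
    simp only [Finset.mem_union, Finset.mem_image, not_or, not_exists, not_and] at he
    exact ⟨e, he.1, he.2⟩
  | ofGuard _ ih => exact .ofGuard (ih σ fresh)
  | plus_assoc => exact .plus_assoc _ _ _
  | plus_comm => exact .plus_comm _ _
  | plus_nil => exact .plus_nil _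
  | par_assoc => exact .par_assoc _ _ _
  | par_comm => exact .par_comm _ _
  | par_nil => exact .par_nil _
  | nu_nil a =>
    rw [nu_subst (c := 0) (by simp [nilP, Tm.fn])]
    exact .nu_nil _
  | nu_comm a b P =>
    by_cases hab : a = b
    · subst hab; exact .refl _
    obtain ⟨c, hc, -⟩ := @fresh P P
    obtain ⟨d, hd⟩ := exists_fresh (P.fn.image σ ∪ {c})
    simp only [Finset.mem_union, Finset.mem_image, Finset.mem_singleton, not_or, not_exists,
      not_and] at hd
    obtain ⟨R, h₁, h₂⟩ := exists_nu_nu_subst hab (Ne.symm hd.2) hc hd.1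
    rw [h₁, h₂]
    exact .nu_comm _ _ _
  | nu_par a P Q ha =>
    obtain ⟨c, hP, hQ⟩ := @fresh P Q
    change StructCong _ (Tm.par ((PiCalc.nu a P).subst σ) (Q.subst σ))
    rw [nu_subst (c := c) fun x hx _ => (Finset.mem_union.1 hx).elim (hP x) (hQ x),
      nu_subst fun x hx _ => hP x hx, ← Tm.subst_update (c := c) ha]
    refine .nu_par _ _ _ fun h => ?_
    change c ∈ (Q.subst _).fn at h
    rw [Tm.subst_update ha] at h
    obtain ⟨x, hx, h⟩ := Tm.mem_fn_subst.1 h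
    exact hQ x hx h
  | rep_unfold => exact .rep_unfold _

/-- Needed because the side conditions of the transition rules mention free names and must carry
over to congruent processes. -/
theorem StructCong.fn_eq {k : Kind} {P Q : Tm k 0} (h : StructCong P Q) : P.fn = Q.fn := by
  induction h with
  | refl => rfl
  | symm _ ih => exact ih.symm
  | trans _ _ ih₁ ih₂ => exact ih₁.trans ih₂
  | out _ _ _ ih => simp [outP, Tm.fn, ih]
  | inp a b _ ih =>
    ext x
    simp [inpP, Tm.fn, Tm.mem_fn_close, ih]
  | tau _ ih | rep _ ih | ofGuard _ ih => exact ih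
  | plus _ _ ih₁ ih₂ | par _ _ ih₁ ih₂ => simp [Tm.fn, ih₁, ih₂]
  | nu a _ ih =>
    ext x
    simp [mem_fn_nu, ih]
  | plus_assoc | par_assoc => simp [Tm.fn, Finset.union_assoc]
  | plus_comm | par_comm => simp [Tm.fn, Finset.union_comm]
  | plus_nil | par_nil => simp [Tm.fn, nilP]
  | nu_nil a =>
    ext x
    simp [mem_fn_nu, nilP, Tm.fn]
  | nu_comm a b P =>
    ext x
    simp only [mem_fn_nu]
    tauto
  | nu_par a P Q ha =>
    ext x
    simp only [mem_fn_nu, Tm.fn, Finset.mem_union]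
    refine ⟨by tauto, ?_⟩
    rintro (h | h)
    · exact ⟨.inl h.1, h.2⟩
    · exact ⟨.inr h, by rintro rfl; exact ha h⟩
  | rep_unfold => simp [Tm.fn]

theorem StructCong.par_right_comm (P Q R : Proc) :
    StructCong (.par (.par P Q) R) (.par (.par P R) Q) :=
  (StructCong.par_assoc _ _ _).trans
    ((StructCong.par (.refl _) (.par_comm _ _)).trans (StructCong.par_assoc _ _ _).symm)

/-- `Q` matches the transitions of `P` strongly, up to structural congruence. -/
def StrongSim (P Q : Proc) : Prop :=
  ∀ μ P', Step P μ P' → ∃ Q', Step Q μ Q' ∧ StructCong P' Q'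

theorem StrongSim.refl (P : Proc) : StrongSim P P := fun _ P' h => ⟨P', h, .refl _⟩

theorem StrongSim.trans {P Q R : Proc} (h₁ : StrongSim P Q) (h₂ : StrongSim Q R) :
    StrongSim P R := fun μ _ h => by
  obtain ⟨Q', h, c⟩ := h₁ μ _ h
  obtain ⟨R', h, c'⟩ := h₂ μ _ h
  exact ⟨R', h, c.trans c'⟩

theorem StrongSim.perm {P Q : Proc} (h : StrongSim P Q) (π : Equiv.Perm Name) :
    StrongSim (P.subst π) (Q.subst π) := fun μ P' hs => by
  have key := hs.perm π.symm
  rw [subst_perm_symm] at key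
  obtain ⟨Q', hQ, c⟩ := h _ _ key
  refine ⟨Q'.subst π, ?_, ?_⟩
  · simpa only [Label.subst_symm_perm] using hQ.perm π
  · simpa only [subst_symm_perm] using c.subst π

theorem StrongSim.par {P P₁ Q Q₁ : Proc} (hP : StructCong P P₁) (hQ : StructCong Q Q₁)
    (sP : StrongSim P P₁) (sQ : StrongSim Q Q₁) : StrongSim (.par P Q) (.par P₁ Q₁) := by
  intro μ X h
  cases h with
  | parL hd h =>
    obtain ⟨P', h, c⟩ := sP _ _ h
    exact ⟨_, .parL (hQ.fn_eq ▸ hd) h, .par c hQ⟩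
  | parR hd h =>
    obtain ⟨Q', h, c⟩ := sQ _ _ h
    exact ⟨_, .parR (hP.fn_eq ▸ hd) h, .par hP c⟩
  | commL h₁ h₂ =>
    obtain ⟨P', h₁, c₁⟩ := sP _ _ h₁
    obtain ⟨Q', h₂, c₂⟩ := sQ _ _ h₂
    exact ⟨_, .commL h₁ h₂, .par c₁ c₂⟩
  | commR h₁ h₂ =>
    obtain ⟨P', h₁, c₁⟩ := sP _ _ h₁
    obtain ⟨Q', h₂, c₂⟩ := sQ _ _ h₂
    exact ⟨_, .commR h₁ h₂, .par c₁ c₂⟩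
  | closeL hb h₁ h₂ =>
    obtain ⟨P', h₁, c₁⟩ := sP _ _ h₁
    obtain ⟨Q', h₂, c₂⟩ := sQ _ _ h₂
    exact ⟨_, .closeL (hP.fn_eq ▸ hb) h₁ h₂, .nu _ (.par c₁ c₂)⟩
  | closeR hb h₁ h₂ =>
    obtain ⟨P', h₁, c₁⟩ := sP _ _ h₁
    obtain ⟨Q', h₂, c₂⟩ := sQ _ _ h₂
    exact ⟨_, .closeR (hQ.fn_eq ▸ hb) h₁ h₂, .nu _ (.par c₁ c₂)⟩

theorem StrongSim.par_comm (P Q : Proc) : StrongSim (.par P Q) (.par Q P) := by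
  intro μ X h
  cases h with
  | parL hd h => exact ⟨_, .parR hd h, .par_comm _ _⟩
  | parR hd h => exact ⟨_, .parL hd h, .par_comm _ _⟩
  | commL h₁ h₂ => exact ⟨_, .commR h₂ h₁, .par_comm _ _⟩
  | commR h₁ h₂ => exact ⟨_, .commL h₂ h₁, .par_comm _ _⟩
  | closeL hb h₁ h₂ => exact ⟨_, .closeR hb h₂ h₁, .nu _ (.par_comm _ _)⟩
  | closeR hb h₁ h₂ => exact ⟨_, .closeL hb h₂ h₁, .nu _ (.par_comm _ _)⟩

theorem disjoint_fn_par {A : Finset Name} {P Q : Proc} (hP : Disjoint A P.fn)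
    (hQ : Disjoint A Q.fn) : Disjoint A (Tm.par P Q).fn :=
  Finset.disjoint_union_right.2 ⟨hP, hQ⟩

theorem disjoint_of_fn_par {A : Finset Name} {P Q : Proc} (h : Disjoint A (Tm.par P Q).fn) :
    Disjoint A P.fn ∧ Disjoint A Q.fn :=
  Finset.disjoint_union_right.1 h

theorem notMem_fn_par {a : Name} {P Q : Proc} :
    a ∉ (Tm.par P Q).fn ↔ a ∉ P.fn ∧ a ∉ Q.fn := by
  simp [Tm.fn]

theorem StrongSim.par_assoc (P Q R : Proc) :
    StrongSim (.par (.par P Q) R) (.par P (.par Q R)) := by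
  intro μ X hs
  cases hs.par_inv ∅ with
  | parL hd hl =>
    cases hl.par_inv R.fn with
    | parL hd' h => exact ⟨_, .parL (disjoint_fn_par hd' hd) h, .par_assoc _ _ _⟩
    | parR hd' h => exact ⟨_, .parR hd' (.parL hd h), .par_assoc _ _ _⟩
    | commL h₁ h₂ => exact ⟨_, .commL h₁ (.parL (by simp [Label.bn]) h₂), .par_assoc _ _ _⟩
    | commR h₁ h₂ => exact ⟨_, .commR h₁ (.parL (by simp [Label.bn]) h₂), .par_assoc _ _ _⟩
    | closeL hb hbP hbQ h₁ h₂ =>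
      exact ⟨_, .closeL hbP h₁ (.parL (by simpa [Label.bn] using hb) h₂),
        (StructCong.nu_par _ _ _ hb).symm.trans (.nu _ (.par_assoc _ _ _))⟩
    | closeR hb hbP hbQ h₁ h₂ =>
      exact ⟨_, .closeR (notMem_fn_par.2 ⟨hbQ, hb⟩) h₁ (.parL (by simp [Label.bn]) h₂),
        (StructCong.nu_par _ _ _ hb).symm.trans (.nu _ (.par_assoc _ _ _))⟩
  | parR hd h =>
    have hd := disjoint_of_fn_par hd
    exact ⟨_, .parR hd.1 (.parR hd.2 h), .par_assoc _ _ _⟩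
  | commL hl h₂ =>
    cases hl with
    | parL _ h₁ => exact ⟨_, .commL h₁ (.parR (by simp [Label.bn]) h₂), .par_assoc _ _ _⟩
    | parR _ h₁ => exact ⟨_, .parR (by simp [Label.bn]) (.commL h₁ h₂), .par_assoc _ _ _⟩
  | commR hl h₂ =>
    cases hl with
    | parL _ h₁ => exact ⟨_, .commR h₁ (.parR (by simp [Label.bn]) h₂), .par_assoc _ _ _⟩
    | parR _ h₁ => exact ⟨_, .parR (by simp [Label.bn]) (.commR h₁ h₂), .par_assoc _ _ _⟩
  | closeL _ hb hbR hl h₂ =>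
    obtain ⟨hbP, hbQ⟩ := notMem_fn_par.1 hb
    cases hl with
    | parL _ h₁ =>
      exact ⟨_, .closeL hbP h₁ (.parR (by simpa [Label.bn] using hbQ) h₂),
        .nu _ (.par_assoc _ _ _)⟩
    | parR _ h₁ =>
      refine ⟨_, .parR (by simp [Label.bn]) (.closeL hbQ h₁ h₂), ?_⟩
      exact (StructCong.nu _ ((StructCong.par_assoc _ _ _).trans (.par_comm _ _))).trans
        ((StructCong.nu_par _ _ _ hbP).trans (.par_comm _ _))
  | closeR _ hb hbR hl h₂ =>
    obtain ⟨hbP, hbQ⟩ := notMem_fn_par.1 hb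
    cases hl with
    | parL _ h₁ =>
      exact ⟨_, .closeR (notMem_fn_par.2 ⟨hbQ, hbR⟩) h₁ (.parR (by simp [Label.bn]) h₂),
        .nu _ (.par_assoc _ _ _)⟩
    | parR _ h₁ =>
      refine ⟨_, .parR (by simp [Label.bn]) (.closeR hbR h₁ h₂), ?_⟩
      exact (StructCong.nu _ ((StructCong.par_assoc _ _ _).trans (.par_comm _ _))).trans
        ((StructCong.nu_par _ _ _ hbP).trans (.par_comm _ _))

theorem StrongSim.par_assoc_symm (P Q R : Proc) :
    StrongSim (.par P (.par Q R)) (.par (.par P Q) R) :=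
  (StrongSim.par_comm _ _).trans <|
    (StrongSim.par (.par_comm _ _) (.refl _) (.par_comm _ _) (.refl _)).trans <|
    (StrongSim.par_assoc _ _ _).trans <| (StrongSim.par_comm _ _).trans <|
    StrongSim.par (.par_comm _ _) (.refl _) (.par_comm _ _) (.refl _)

theorem StrongSim.nu {P Q : Proc} (a : Name) (hPQ : StructCong P Q) (s : StrongSim P Q) :
    StrongSim (nu a P) (nu a Q) := by
  intro μ X hs
  obtain ⟨c, hc⟩ := exists_fresh (P.fn ∪ μ.names)
  simp only [Finset.mem_union, not_or] at hc
  have hcP : c ∉ (PiCalc.nu a P).fn := fun h => hc.1 (mem_fn_nu.1 h).1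
  have hcQ : c ∉ (PiCalc.nu a Q).fn := (StructCong.nu a hPQ).fn_eq ▸ hcP
  rw [nu_swap hcP] at hs
  rw [nu_swap hcQ]
  have s' := s.perm (Equiv.swap a c)
  have hPQ' := hPQ.subst (Equiv.swap a c)
  rcases hs.nu_inv hc.2 with ⟨e, b, rfl, hb, hbe, -, -, h⟩ | ⟨P', h, rfl⟩
  · obtain ⟨Y, hY, cY⟩ := s'.perm _ _ _ h
    refine ⟨Y, ?_, cY⟩
    rw [nu_swap ((StructCong.nu c hPQ').fn_eq ▸ hb)]
    exact hY.nu_open hbe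
  · obtain ⟨Y, hY, cY⟩ := s' _ _ h
    exact ⟨_, hY.nu hc.2, .nu _ cY⟩

/-- Both restricted names are first made fresh for the label; swapping the restrictions then only
exchanges the order in which the rules `res` and `opn` are applied. -/
theorem StrongSim.nu_comm (a b : Name) (P : Proc) :
    StrongSim (PiCalc.nu a (PiCalc.nu b P)) (PiCalc.nu b (PiCalc.nu a P)) := by
  intro μ X hs
  by_cases hab : a = b
  · subst hab; exact ⟨X, hs, .refl _⟩
  obtain ⟨c, hc⟩ := exists_fresh (P.fn ∪ μ.names)
  obtain ⟨d, hd⟩ := exists_fresh (P.fn ∪ μ.names ∪ {c})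
  simp only [Finset.mem_union, Finset.mem_singleton, not_or] at hc hd
  obtain ⟨R, h₁, h₂⟩ := exists_nu_nu_subst (σ := id) hab (Ne.symm hd.2)
    (fun x hx => by rintro rfl; exact hc.1 hx) (fun x hx => by rintro rfl; exact hd.1.1 hx)
  rw [Tm.subst_id] at h₁ h₂
  rw [h₂]
  rw [h₁] at hs
  clear h₁ h₂
  obtain ⟨⟨-, hd⟩, hdc⟩ := hd
  replace hc := hc.2
  -- Three cases arise: the outer name is extruded, the inner name is extruded, or neither is.
  rcases hs.nu_inv hc with ⟨e, b', rfl, -, hbe, hbc, hbR, ht⟩ | ⟨Y, ht, rfl⟩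
  · have hdb : d ≠ b' := by rintro rfl; exact hd (by simp [Label.names])
    rw [nu_perm, Equiv.swap_apply_of_ne_of_ne hdc hdb] at ht
    rcases ht.nu_inv hd with ⟨_, _, h, -⟩ | ⟨P', h, rfl⟩
    · cases h
    refine ⟨_, Step.nu ?_ hd, .refl _⟩
    rw [nu_swap (a := c) (b := b')]
    · exact h.nu_open hbe
    · exact fun h => hbR (mem_fn_nu.2 ⟨(mem_fn_nu.1 h).1, hdb.symm⟩)
  · rcases ht.nu_inv hd with ⟨e, b', rfl, -, hbe, hbd, hbR, h⟩ | ⟨P', h, rfl⟩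
    · have hcb : c ≠ b' := by rintro rfl; exact hc (by simp [Label.names])
      refine ⟨_, ?_, .refl _⟩
      rw [nu_swap (a := d) (b := b')]
      · rw [nu_perm, Equiv.swap_apply_of_ne_of_ne (Ne.symm hdc) hcb]
        exact Step.nu_open (h.nu hc) hbe
      · exact fun h => hbR (mem_fn_nu.1 (mem_fn_nu.1 h).1).1
    · exact ⟨_, (h.nu hc).nu hd, .nu_comm _ _ _⟩

theorem exists_nu_par_eq {a : Name} (P : Proc) {Q : Proc} (ha : a ∉ Q.fn) (A : Finset Name) :
    ∃ c P₀, c ∉ A ∧ nu a P = nu c P₀ ∧ nu a (.par P Q) = nu c (.par P₀ Q) := by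
  obtain ⟨c, hc⟩ := exists_fresh (A ∪ P.fn ∪ Q.fn)
  simp only [Finset.mem_union, not_or] at hc
  refine ⟨c, P.subst (Equiv.swap a c), hc.1.1, nu_swap fun h => hc.1.2 (mem_fn_nu.1 h).1, ?_⟩
  rw [nu_swap (b := c)]
  · change nu c (.par _ (Q.subst _)) = _
    rw [Tm.subst_swap_eq_self ha hc.2]
    rfl
  · exact fun h => notMem_fn_par.2 ⟨hc.1.2, hc.2⟩ (mem_fn_nu.1 h).1

/-- Moving the scope inwards can change the kind of a communication: if `P` sends the restricted
name itself to `Q`, a plain communication under the restriction becomes a scope extrusion. -/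
theorem StrongSim.nu_par {a : Name} (P : Proc) {Q : Proc} (ha : a ∉ Q.fn) :
    StrongSim (PiCalc.nu a (.par P Q)) (.par (PiCalc.nu a P) Q) := by
  intro μ X hs
  obtain ⟨c, P₀, hc, h₁, h₂⟩ := exists_nu_par_eq P ha (Q.fn ∪ μ.names)
  rw [h₁]
  rw [h₂] at hs
  simp only [Finset.mem_union, not_or] at hc
  obtain ⟨hcQ, hc⟩ := hc
  rcases hs.nu_inv hc with ⟨e, b, rfl, -, hbe, -, hb, ht⟩ | ⟨Y, ht, rfl⟩
  · obtain ⟨hbP, hbQ⟩ := notMem_fn_par.1 hb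
    change Step (.par (P₀.subst _) (Q.subst _)) _ _ at ht
    rw [Tm.subst_swap_eq_self hcQ hbQ] at ht
    cases ht with
    | parL _ h =>
      refine ⟨_, .parL (by simpa [Label.bn] using hbQ) ?_, .refl _⟩
      rw [nu_swap (b := b) fun h => hbP (mem_fn_nu.1 h).1]
      exact h.nu_open hbe
    | parR _ h => exact absurd h.out_mem.2 hbQ
  · cases ht.par_inv {c} with
    | parL hd h => exact ⟨_, .parL hd (h.nu hc), .nu_par _ _ _ hcQ⟩
    | @parR _ Q' hd h =>
      have hcQ' : c ∉ Q'.fn := fun h' => (h.mem_fn h').elim hcQ hc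
      refine ⟨_, .parR (Finset.disjoint_left.2 fun x hx hx' => ?_) h, .nu_par _ _ _ hcQ'⟩
      exact Finset.disjoint_left.1 hd hx (mem_fn_nu.1 hx').1
    | @commL P' Q' d b h₁ h₂ =>
      have hcd : c ∉ (Label.inp d b).names := by
        simp only [Label.names, Finset.mem_insert, Finset.mem_singleton, not_or]
        exact ⟨fun h => hcQ (h ▸ h₂.out_mem.1), fun h => hcQ (h ▸ h₂.out_mem.2)⟩
      have hcQ' : c ∉ Q'.fn := fun h' => (h₂.mem_fn h').elim hcQ hcd
      exact ⟨_, .commL (h₁.nu hcd) h₂, .nu_par _ _ _ hcQ'⟩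
    | @commR P' Q' d b h₁ h₂ =>
      have hcd : c ≠ d := fun h => hcQ (h ▸ h₂.inp_mem)
      -- When the transmitted name is the restricted one, the left component performs a bound output
      -- and `closeR` replaces `commR`.
      by_cases hcb : c = b
      · subst hcb
        exact ⟨_, .closeR hcQ (h₁.nu_open hcd) h₂, .refl _⟩
      · have hn : c ∉ (Label.out d b).names := by simp [Label.names, hcd, hcb]
        have hcQ' : c ∉ Q'.fn := fun h' => (h₂.mem_fn h').elim hcQ hn
        exact ⟨_, .commR (h₁.nu hn) h₂, .nu_par _ _ _ hcQ'⟩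
    | @closeL P' Q' d b hb hbP hbQ h₁ h₂ =>
      have hcb : c ≠ b := fun h => hb (by simp [h])
      have hcd : c ≠ d := fun h => hcQ (h ▸ h₂.bout_mem.1)
      have hn : c ∉ (Label.inp d b).names := by simp [Label.names, hcd, hcb]
      have hcQ' : c ∉ Q'.fn := fun h' => (h₂.mem_fn h').elim hcQ hn
      exact ⟨_, .closeL (fun h => hbP (mem_fn_nu.1 h).1) (h₁.nu hn) h₂,
        (StructCong.nu_comm _ _ _).trans (.nu _ (.nu_par _ _ _ hcQ'))⟩
    | @closeR P' Q' d b hb hbP hbQ h₁ h₂ =>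
      have hcb : c ≠ b := fun h => hb (by simp [h])
      have hcd : c ≠ d := fun h => hcQ (h ▸ h₂.inp_mem)
      have hn : c ∉ (Label.bout d b).names := by simp [Label.names, hcd, hcb]
      have hcQ' : c ∉ Q'.fn := fun h' => (h₂.mem_fn h').elim hcQ hn
      exact ⟨_, .closeR hbQ (h₁.nu hn) h₂,
        (StructCong.nu_comm _ _ _).trans (.nu _ (.nu_par _ _ _ hcQ'))⟩

theorem StrongSim.nu_par_symm {a : Name} (P : Proc) {Q : Proc} (ha : a ∉ Q.fn) :
    StrongSim (.par (PiCalc.nu a P) Q) (PiCalc.nu a (.par P Q)) := by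
  intro μ X hs
  obtain ⟨c, P₀, hc, h₁, h₂⟩ := exists_nu_par_eq P ha (Q.fn ∪ μ.names)
  rw [h₂]
  rw [h₁] at hs
  simp only [Finset.mem_union, not_or] at hc
  obtain ⟨hcQ, hc⟩ := hc
  have open_eq : ∀ {b : Name}, b ∉ (PiCalc.nu c P₀).fn → b ∉ Q.fn →
      PiCalc.nu c (.par P₀ Q) = PiCalc.nu b (.par (P₀.subst (Equiv.swap c b)) Q) := by
    intro b hb hbQ
    rw [nu_swap (b := b)]
    · change PiCalc.nu b (.par (P₀.subst _) (Q.subst _)) = _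
      rw [Tm.subst_swap_eq_self hcQ hbQ]
    · intro h
      obtain ⟨h, hbc⟩ := mem_fn_nu.1 h
      exact notMem_fn_par.2 ⟨fun h => hb (mem_fn_nu.2 ⟨h, hbc⟩), hbQ⟩ h
  cases hs.par_inv {c} with
  | parL hd ht =>
    rcases ht.nu_inv hc with ⟨e, b, rfl, hb, hbe, -, -, h⟩ | ⟨Y, h, rfl⟩
    · have hbQ : b ∉ Q.fn := by simpa [Label.bn] using hd
      rw [open_eq hb hbQ]
      exact ⟨_, Step.nu_open (.parL (by simp [Label.bn]) h) hbe, .refl _⟩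
    · refine ⟨_, Step.nu (.parL hd h) hc, (StructCong.nu_par _ _ _ hcQ).symm⟩
  | @parR _ Q' hd h =>
    have hcQ' : c ∉ Q'.fn := fun h' => (h.mem_fn h').elim hcQ hc
    refine ⟨_, Step.nu (.parR (Finset.disjoint_left.2 fun x hx hx' => ?_) h) hc,
      (StructCong.nu_par _ _ _ hcQ').symm⟩
    have hxc : x ≠ c := by rintro rfl; exact hc (Label.bn_subset_names _ hx)
    exact Finset.disjoint_left.1 hd hx (mem_fn_nu.2 ⟨hx', hxc⟩)
  | @commL P' Q' d b h₁ h₂ =>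
    have hcd : c ∉ (Label.inp d b).names := by
      simp only [Label.names, Finset.mem_insert, Finset.mem_singleton, not_or]
      exact ⟨fun h => hcQ (h ▸ h₂.out_mem.1), fun h => hcQ (h ▸ h₂.out_mem.2)⟩
    have hcQ' : c ∉ Q'.fn := fun h' => (h₂.mem_fn h').elim hcQ hcd
    rcases h₁.nu_inv hcd with ⟨_, _, h, -⟩ | ⟨Y, h, rfl⟩
    · cases h
    · exact ⟨_, Step.nu (.commL h h₂) hc, (StructCong.nu_par _ _ _ hcQ').symm⟩
  | @commR P' Q' d b h₁ h₂ =>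
    have hcd : c ∉ (Label.out d b).names := by
      simp only [Label.names, Finset.mem_insert, Finset.mem_singleton, not_or]
      exact ⟨fun h => (mem_fn_nu.1 h₁.out_mem.1).2 h.symm,
        fun h => (mem_fn_nu.1 h₁.out_mem.2).2 h.symm⟩
    have hcQ' : c ∉ Q'.fn := fun h' => (h₂.mem_fn h').elim hcQ hcd
    rcases h₁.nu_inv hcd with ⟨_, _, h, -⟩ | ⟨Y, h, rfl⟩
    · cases h
    · exact ⟨_, Step.nu (.commR h h₂) hc, (StructCong.nu_par _ _ _ hcQ').symm⟩
  | @closeL P' Q' d b hb hbP hbQ h₁ h₂ =>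
    have hcb : c ≠ b := fun h => hb (by simp [h])
    have hcd : c ≠ d := fun h => hcQ (h ▸ h₂.bout_mem.1)
    have hn : c ∉ (Label.inp d b).names := by simp [Label.names, hcd, hcb]
    have hcQ' : c ∉ Q'.fn := fun h' => (h₂.mem_fn h').elim hcQ hn
    rcases h₁.nu_inv hn with ⟨_, _, h, -⟩ | ⟨Y, h, rfl⟩
    · cases h
    · exact ⟨_, Step.nu (.closeL (fun h => hbP (mem_fn_nu.2 ⟨h, hcb.symm⟩)) h h₂) hc,
        ((StructCong.nu_comm _ _ _).trans (.nu _ (.nu_par _ _ _ hcQ'))).symm⟩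
  | @closeR P' Q' d b hb hbP hbQ h₁ h₂ =>
    have hcb : c ≠ b := fun h => hb (by simp [h])
    have hcd : c ≠ d := fun h => (mem_fn_nu.1 h₁.bout_mem.1).2 h.symm
    have hn : c ∉ (Label.bout d b).names := by simp [Label.names, hcd, hcb]
    have hcQ' : c ∉ Q'.fn := fun h' => (h₂.mem_fn h').elim hcQ hn
    -- In the first case the extruded name is the restricted one; with `Q` already in its scope, a
    -- plain communication suffices.
    rcases h₁.nu_inv hn with ⟨e, b', h, hb', hbe, -, -, h'⟩ | ⟨Y, h, rfl⟩
    · cases h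
      rw [open_eq hb' hbQ]
      exact ⟨_, Step.nu (.commR h' h₂) (by simp [Label.names]), .refl _⟩
    · exact ⟨_, Step.nu (.closeR hbQ h h₂) hc,
        ((StructCong.nu_comm _ _ _).trans (.nu _ (.nu_par _ _ _ hcQ'))).symm⟩

/-! ### Transitions of replicated guarded sums. -/

/-- A derivation unfolds `!G` several times, but idle copies of `G` are folded back by `≡`, leaving
only the one or two that act. A guarded sum has no bound outputs, so scope extrusion between copies
does not occur. -/
theorem Step.rep_inv {G : Guard} {μ : Label} {X : Proc} (h : Step (.rep G) μ X) :
    (∃ P₁, Step (.ofGuard G) μ P₁ ∧ StructCong X (.par (.rep G) P₁)) ∨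
      (μ = .tau ∧ ∃ a b P₁ P₂, Step (.ofGuard G) (.inp a b) P₁ ∧
        Step (.ofGuard G) (.out a b) P₂ ∧ StructCong X (.par (.par (.rep G) P₁) P₂)) := by
  have unfold : ∀ P, StructCong (.par (.par (.rep G) P) (.ofGuard G)) (.par (.rep G) P) :=
    fun P => (StructCong.par_right_comm _ _ _).trans
      (StructCong.par (StructCong.rep_unfold G).symm (.refl _))
  -- The derivation alternates between `!G` and its unfolding `!G | G`, so the induction covers both
  -- as sources.
  have main : ∀ {Y μ X}, Step Y μ X → Y = .rep G ∨ Y = .par (.rep G) (.ofGuard G) →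
      (∃ P₁, Step (.ofGuard G) μ P₁ ∧ StructCong X (.par (.rep G) P₁)) ∨
      (μ = .tau ∧ ∃ a b P₁ P₂, Step (.ofGuard G) (.inp a b) P₁ ∧
        Step (.ofGuard G) (.out a b) P₂ ∧ StructCong X (.par (.par (.rep G) P₁) P₂)) := by
    intro Y μ X h hY
    induction h with
    | rep h ih =>
      rcases hY with hY | hY <;> cases hY
      exact ih (.inr rfl)
    | parL _ h ih =>
      rcases hY with hY | hY <;> cases hY
      rcases ih (.inl rfl) with ⟨P₁, h, c⟩ | ⟨hμ, a, b, P₁, P₂, h₁, h₂, c⟩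
      · exact .inl ⟨P₁, h, (StructCong.par c (.refl _)).trans (unfold _)⟩
      · exact .inr ⟨hμ, a, b, P₁, P₂, h₁, h₂, (StructCong.par c (.refl _)).trans
          ((StructCong.par_right_comm _ _ _).trans (StructCong.par (unfold _) (.refl _)))⟩
    | parR _ h ih =>
      rcases hY with hY | hY <;> cases hY
      exact .inl ⟨_, h, .refl _⟩
    | commL h₁ h₂ ih =>
      rcases hY with hY | hY <;> cases hY
      rcases ih (.inl rfl) with ⟨P₁, h, c⟩ | ⟨hμ, -⟩
      · exact .inr ⟨rfl, _, _, _, _, h, h₂, StructCong.par c (.refl _)⟩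
      · cases hμ
    | commR h₁ h₂ ih =>
      rcases hY with hY | hY <;> cases hY
      rcases ih (.inl rfl) with ⟨P₁, h, c⟩ | ⟨hμ, -⟩
      · exact .inr ⟨rfl, _, _, _, _, h₂, h, (StructCong.par c (.refl _)).trans
          (.par_right_comm _ _ _)⟩
      · cases hμ
    | closeL _ h₁ h₂ =>
      rcases hY with hY | hY <;> cases hY
      exact absurd h₂.guard_bn (by simp [Label.bn])
    | closeR _ h₁ h₂ ih =>
      rcases hY with hY | hY <;> cases hY
      rcases ih (.inl rfl) with ⟨P₁, h, c⟩ | ⟨hμ, -⟩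
      · exact absurd h.guard_bn (by simp [Label.bn])
      · cases hμ
    | _ => rcases hY with hY | hY <;> cases hY
  exact main h (.inl rfl)

theorem Step.rep_intro {G : Guard} {μ : Label} {P : Proc} (h : Step (.ofGuard G) μ P) :
    Step (.rep G) μ (.par (.rep G) P) :=
  .rep (.parR (by simp [h.guard_bn]) h)

theorem StrongSim.rep {G H : Guard} (hGH : StructCong G H)
    (s : StrongSim (.ofGuard G) (.ofGuard H)) : StrongSim (.rep G) (.rep H) := by
  intro μ X h
  rcases h.rep_inv with ⟨P₁, h, c⟩ | ⟨rfl, a, b, P₁, P₂, h₁, h₂, c⟩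
  · obtain ⟨Q₁, h, c'⟩ := s _ _ h
    exact ⟨_, h.rep_intro, c.trans (.par (.rep hGH) c')⟩
  · obtain ⟨Q₁, h₁, c₁⟩ := s _ _ h₁
    obtain ⟨Q₂, h₂, c₂⟩ := s _ _ h₂
    exact ⟨_, .rep (.commL h₁.rep_intro h₂), c.trans (.par (.par (.rep hGH) c₁) c₂)⟩

/-- A term seen as a process. -/
def Tm.toProc : {k : Kind} → Tm k 0 → Proc
  | .guard, G => .ofGuard G
  | .proc, P => P

theorem not_step_nil {μ : Label} {X : Proc} : ¬ Step nilP μ X := fun h => by cases h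

/-- Both directions are proved together because the symmetry rule exchanges them. The main work lies
in the scope laws and in replication, treated above. -/
theorem StructCong.strongSim {k : Kind} {P Q : Tm k 0} (h : StructCong P Q) :
    StrongSim P.toProc Q.toProc ∧ StrongSim Q.toProc P.toProc := by
  have inp : ∀ (a b : Name) (P Q : Proc), StructCong P Q →
      StrongSim (.ofGuard (inpP a b P)) (.ofGuard (inpP a b Q)) := by
    intro a b P Q hPQ μ X h
    cases h
    refine ⟨_, .inp _ _ _, ?_⟩
    rw [Tm.close_inst, Tm.close_inst]
    exact hPQ.subst _
  have out : ∀ (a b : Name) (P Q : Proc), StructCong P Q →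
      StrongSim (.ofGuard (outP a b P)) (.ofGuard (outP a b Q)) := by
    intro a b P Q hPQ μ X h
    cases h
    exact ⟨_, .out _ _ _, hPQ⟩
  have tau : ∀ (P Q : Proc), StructCong P Q →
      StrongSim (.ofGuard (.tau P)) (.ofGuard (.tau Q)) := by
    intro P Q hPQ μ X h
    cases h
    exact ⟨_, .tau _, hPQ⟩
  have plus : ∀ (G G' H H' : Guard), StrongSim (.ofGuard G) (.ofGuard G') →
      StrongSim (.ofGuard H) (.ofGuard H') →
      StrongSim (.ofGuard (.plus G H)) (.ofGuard (.plus G' H')) := by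
    intro G G' H H' s₁ s₂ μ X h
    cases h with
    | sumL h => obtain ⟨Y, h, c⟩ := s₁ _ _ h; exact ⟨_, .sumL h, c⟩
    | sumR h => obtain ⟨Y, h, c⟩ := s₂ _ _ h; exact ⟨_, .sumR h, c⟩
  have plus_comm : ∀ G H : Guard, StrongSim (.ofGuard (.plus G H)) (.ofGuard (.plus H G)) := by
    intro G H μ X h
    cases h with
    | sumL h => exact ⟨_, .sumR h, .refl _⟩
    | sumR h => exact ⟨_, .sumL h, .refl _⟩
  induction h with
  | refl P => exact ⟨.refl _, .refl _⟩
  | symm _ ih => exact ih.symm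
  | trans _ _ ih₁ ih₂ => exact ⟨ih₁.1.trans ih₂.1, ih₂.2.trans ih₁.2⟩
  | out a b h _ => exact ⟨out _ _ _ _ h, out _ _ _ _ h.symm⟩
  | inp a b h _ => exact ⟨inp _ _ _ _ h, inp _ _ _ _ h.symm⟩
  | tau h _ => exact ⟨tau _ _ h, tau _ _ h.symm⟩
  | plus _ _ ih₁ ih₂ => exact ⟨plus _ _ _ _ ih₁.1 ih₂.1, plus _ _ _ _ ih₁.2 ih₂.2⟩
  | rep h ih => exact ⟨.rep h ih.1, .rep h.symm ih.2⟩
  | par h₁ h₂ ih₁ ih₂ => exact ⟨.par h₁ h₂ ih₁.1 ih₂.1, .par h₁.symm h₂.symm ih₁.2 ih₂.2⟩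
  | nu a h ih => exact ⟨.nu a h ih.1, .nu a h.symm ih.2⟩
  | ofGuard _ ih => exact ih
  | plus_assoc G H K =>
    constructor
    · intro μ X h
      cases h with
      | sumL h =>
        cases h with
        | sumL h => exact ⟨_, .sumL h, .refl _⟩
        | sumR h => exact ⟨_, .sumR (.sumL h), .refl _⟩
      | sumR h => exact ⟨_, .sumR (.sumR h), .refl _⟩
    · intro μ X h
      cases h with
      | sumL h => exact ⟨_, .sumL (.sumL h), .refl _⟩
      | sumR h =>
        cases h with
        | sumL h => exact ⟨_, .sumL (.sumR h), .refl _⟩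
        | sumR h => exact ⟨_, .sumR h, .refl _⟩
  | plus_comm G H => exact ⟨plus_comm _ _, plus_comm _ _⟩
  | plus_nil G =>
    refine ⟨fun μ X h => ?_, fun μ X h => ⟨_, .sumL h, .refl _⟩⟩
    cases h with
    | sumL h => exact ⟨_, h, .refl _⟩
    | sumR h => cases h
  | par_assoc P Q R => exact ⟨.par_assoc _ _ _, .par_assoc_symm _ _ _⟩
  | par_comm P Q => exact ⟨.par_comm _ _, .par_comm _ _⟩
  | par_nil P =>
    refine ⟨fun μ X h => ?_, fun μ X h => ⟨_, .parL (by simp [nilP, Tm.fn]) h,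
      (StructCong.par_nil _).symm⟩⟩
    cases h with
    | parL _ h => exact ⟨_, h, .par_nil _⟩
    | parR _ h => exact absurd h not_step_nil
    | commL _ h => exact absurd h not_step_nil
    | commR _ h => exact absurd h not_step_nil
    | closeL _ _ h => exact absurd h not_step_nil
    | closeR _ _ h => exact absurd h not_step_nil
  | nu_nil a =>
    refine ⟨fun μ X h => ?_, fun μ X h => absurd h not_step_nil⟩
    cases h with
    | opn _ _ h => exact absurd h not_step_nil
    | res _ _ h => exact absurd h not_step_nil
  | nu_comm a b P => exact ⟨.nu_comm _ _ _, .nu_comm _ _ _⟩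
  | nu_par a P Q ha => exact ⟨.nu_par _ ha, .nu_par_symm _ ha⟩
  | rep_unfold G =>
    refine ⟨fun μ X h => ?_, fun μ X h => ⟨X, .rep h, .refl _⟩⟩
    cases h with
    | rep h => exact ⟨X, h, .refl _⟩

/-! ## Transitions of a renamed process -/

section Shapes

variable {σ : Name → Name} {P : Proc}

theorem exists_par_of_subst_eq {A B : Proc} (h : P.subst σ = .par A B) :
    ∃ P₁ P₂, P = .par P₁ P₂ ∧ P₁.subst σ = A ∧ P₂.subst σ = B := by
  cases P with
  | par P₁ P₂ => exact ⟨P₁, P₂, rfl, Tm.par.inj h⟩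
  | _ => cases h

theorem exists_rep_of_subst_eq {G : Guard} (h : P.subst σ = .rep G) :
    ∃ H, P = .rep H ∧ H.subst σ = G := by
  cases P with
  | rep H => exact ⟨H, rfl, Tm.rep.inj h⟩
  | _ => cases h

theorem exists_res_of_subst_eq {A : Tm .proc 1} (h : P.subst σ = .res A) :
    ∃ B, P = .res B ∧ B.subst σ = A := by
  cases P with
  | res B => exact ⟨B, rfl, Tm.res.inj ((subst_res σ B).symm.trans h)⟩
  | _ => cases h

theorem exists_guard_of_subst_eq {G : Guard} (h : P.subst σ = .ofGuard G) :
    ∃ H, P = .ofGuard H ∧ H.subst σ = G := by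
  cases P with
  | ofGuard H => exact ⟨H, rfl, Tm.ofGuard.inj h⟩
  | _ => cases h

theorem exists_plus_of_subst_eq {G A B : Guard} (h : G.subst σ = .plus A B) :
    ∃ G₁ G₂, G = .plus G₁ G₂ ∧ G₁.subst σ = A ∧ G₂.subst σ = B := by
  cases G with
  | plus G₁ G₂ => exact ⟨G₁, G₂, rfl, Tm.plus.inj h⟩
  | _ => cases h

theorem exists_tau_of_subst_eq {G : Guard} {A : Proc} (h : G.subst σ = .tau A) :
    ∃ B, G = .tau B ∧ B.subst σ = A := by
  cases G with
  | tau B => exact ⟨B, rfl, Tm.tau.inj h⟩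
  | _ => cases h

theorem exists_out_of_subst_eq {G : Guard} {a b : Name} {A : Proc}
    (h : G.subst σ = .out (.free a) (.free b) A) :
    ∃ a' b' B, G = .out (.free a') (.free b') B ∧ σ a' = a ∧ σ b' = b ∧ B.subst σ = A := by
  cases G with
  | out x y B =>
    cases x with
    | bound i => exact i.elim0
    | free a' =>
      cases y with
      | bound i => exact i.elim0
      | free b' =>
        obtain ⟨h₁, h₂, h₃⟩ := Tm.out.inj h
        exact ⟨a', b', B, rfl, Nm.free.inj h₁, Nm.free.inj h₂, h₃⟩
  | _ => cases h

theorem exists_inp_of_subst_eq {G : Guard} {a : Name} {A : Tm .proc 1}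
    (h : G.subst σ = .inp (.free a) A) :
    ∃ a' B, G = .inp (.free a') B ∧ σ a' = a ∧ B.subst σ = A := by
  cases G with
  | inp x B =>
    cases x with
    | bound i => exact i.elim0
    | free a' =>
      rw [subst_inp] at h
      obtain ⟨h₁, h₂⟩ := Tm.inp.inj h
      exact ⟨a', B, rfl, Nm.free.inj h₁, h₂⟩
  | _ => cases h

end Shapes

/-- The origins of a silent transition from `Pσ` to `X`: a silent transition of `P`, or a
communication between two channels of `P` that `σ` identifies. -/
inductive SilentInv (A : Finset Name) (P : Proc) (σ : Name → Name) (X : Proc) : Prop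
  | tau {P' : Proc} : Step P .tau P' → P'.subst σ = X → SilentInv A P σ X
  | comm {a b c : Name} {P₁ P₂ : Proc} : a ≠ c → σ a = σ c → Step P (.out a b) P₁ →
      Step P₁ (.inp c b) P₂ → StructCong X (P₂.subst σ) → SilentInv A P σ X
  | close {a c d : Name} {P₁ P₂ : Proc} : a ≠ c → σ a = σ c → d ∉ A → c ∈ P.fn →
      Step P (.bout a d) P₁ → Step P₁ (.inp c d) P₂ →
      StructCong X ((nu d P₂).subst σ) → SilentInv A P σ X

/-- The origins of a transition from `Pσ` to `X`. -/
def SubstInv (P : Proc) (σ : Name → Name) : Label → Proc → Prop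
  | .tau, X => ∀ A, SilentInv A P σ X
  | .out a b, X =>
    ∃ a' b' P', σ a' = a ∧ σ b' = b ∧ Step P (.out a' b') P' ∧ P'.subst σ = X
  | .inp a b, X =>
    ∀ b', σ b' = b → ∃ a' P', σ a' = a ∧ Step P (.inp a' b') P' ∧ P'.subst σ = X
  | .bout a b, X => ∀ b', b' ∉ P.fn → σ b' = b →
    ∃ a' P', σ a' = a ∧ Step P (.bout a' b') P' ∧ P'.subst σ = X

theorem SubstInv.mono {P Q : Proc} {σ : Name → Name} {μ : Label} {X : Proc}
    (h : SubstInv P σ μ X) (hfn : P.fn ⊆ Q.fn) (hs : ∀ μ P', Step P μ P' → Step Q μ P') :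
    SubstInv Q σ μ X := by
  cases μ with
  | tau =>
    intro A
    cases h A with
    | tau h e => exact .tau (hs _ _ h) e
    | comm hac e h₁ h₂ c => exact .comm hac e (hs _ _ h₁) h₂ c
    | close hac e hd hc h₁ h₂ c => exact .close hac e hd (hfn hc) (hs _ _ h₁) h₂ c
  | out a b =>
    obtain ⟨a', b', P', ha, hb, h, e⟩ := h
    exact ⟨a', b', P', ha, hb, hs _ _ h, e⟩
  | inp a b =>
    intro b' hb
    obtain ⟨a', P', ha, h, e⟩ := h b' hb
    exact ⟨a', P', ha, hs _ _ h, e⟩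
  | bout a b =>
    intro b' hb' hb
    obtain ⟨a', P', ha, h, e⟩ := h b' (fun h => hb' (hfn h)) hb
    exact ⟨a', P', ha, hs _ _ h, e⟩

theorem subst_nu_par (σ : Name → Name) {d : Name} (P : Proc) {Q : Proc} (hd : d ∉ Q.fn) :
    StructCong ((nu d (.par P Q)).subst σ) (.par ((nu d P).subst σ) (Q.subst σ)) :=
  (StructCong.nu_par d P Q hd).subst σ

/-- The freedom to choose the extruded name is used here: it is taken outside `Q.fn` as well, so
that `Q` can enter its scope. This scope change is one reason why the aliased cases hold only up to
`≡`. -/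
theorem SubstInv.parL {P Q : Proc} {σ : Name → Name} {μ : Label} {X : Proc}
    (h : SubstInv P σ μ X) : SubstInv (.par P Q) σ μ (.par X (Q.subst σ)) := by
  cases μ with
  | tau =>
    intro A
    cases h (A ∪ Q.fn) with
    | tau h e => exact .tau (.parL (by simp [Label.bn]) h) (e ▸ rfl)
    | comm hac e h₁ h₂ c =>
      exact .comm hac e (.parL (by simp [Label.bn]) h₁) (.parL (by simp [Label.bn]) h₂)
        (.par c (.refl _))
    | close hac e hd hc h₁ h₂ c =>
      simp only [Finset.mem_union, not_or] at hd
      exact .close hac e hd.1 (Finset.mem_union_left _ hc)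
        (.parL (by simpa [Label.bn] using hd.2) h₁) (.parL (by simp [Label.bn]) h₂)
        ((StructCong.par c (.refl _)).trans (subst_nu_par σ _ hd.2).symm)
  | out a b =>
    obtain ⟨a', b', P', ha, hb, h, e⟩ := h
    exact ⟨a', b', _, ha, hb, .parL (by simp [Label.bn]) h, e ▸ rfl⟩
  | inp a b =>
    intro b' hb
    obtain ⟨a', P', ha, h, e⟩ := h b' hb
    exact ⟨a', _, ha, .parL (by simp [Label.bn]) h, e ▸ rfl⟩
  | bout a b =>
    intro b' hb' hb
    obtain ⟨hP, hQ⟩ := notMem_fn_par.1 hb'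
    obtain ⟨a', P', ha, h, e⟩ := h b' hP hb
    exact ⟨a', _, ha, .parL (by simpa [Label.bn] using hQ) h, e ▸ rfl⟩

theorem SubstInv.parR {P Q : Proc} {σ : Name → Name} {μ : Label} {X : Proc}
    (h : SubstInv Q σ μ X) : SubstInv (.par P Q) σ μ (.par (P.subst σ) X) := by
  cases μ with
  | tau =>
    intro A
    cases h (A ∪ P.fn) with
    | tau h e => exact .tau (.parR (by simp [Label.bn]) h) (e ▸ rfl)
    | comm hac e h₁ h₂ c =>
      exact .comm hac e (.parR (by simp [Label.bn]) h₁) (.parR (by simp [Label.bn]) h₂)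
        (.par (.refl _) c)
    | @close _ _ d _ _ hac e hd hc h₁ h₂ c =>
      simp only [Finset.mem_union, not_or] at hd
      exact .close hac e hd.1 (Finset.mem_union_right _ hc)
        (.parR (by simpa [Label.bn] using hd.2) h₁) (.parR (by simp [Label.bn]) h₂)
        ((StructCong.par (.refl _) c).trans ((StructCong.par_comm _ _).trans
          ((subst_nu_par σ _ hd.2).symm.trans
            ((StructCong.nu d (.par_comm _ _)).subst σ))))
  | out a b =>
    obtain ⟨a', b', P', ha, hb, h, e⟩ := h
    exact ⟨a', b', _, ha, hb, .parR (by simp [Label.bn]) h, e ▸ rfl⟩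
  | inp a b =>
    intro b' hb
    obtain ⟨a', P', ha, h, e⟩ := h b' hb
    exact ⟨a', _, ha, .parR (by simp [Label.bn]) h, e ▸ rfl⟩
  | bout a b =>
    intro b' hb' hb
    obtain ⟨hP, hQ⟩ := notMem_fn_par.1 hb'
    obtain ⟨a', P', ha, h, e⟩ := h b' hQ hb
    exact ⟨a', _, ha, .parR (by simpa [Label.bn] using hP) h, e ▸ rfl⟩

/-- Restriction of a name whose image `b` under the renaming is fresh. -/
theorem SubstInv.res {P : Tm .proc 1} {σ : Name → Name} {μ : Label} {X : Proc} {b : Name}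
    (hb : b ∉ (P.subst σ).fn) (hbμ : b ∉ μ.names)
    (h : ∀ c ∉ P.fn, SubstInv (P.inst c) (Function.update σ c b) μ X) :
    SubstInv (.res P) σ μ (nu b X) := by
  have fresh : ∀ A : Finset Name, ∃ c, c ∉ A ∧ c ∉ P.fn := fun A => by
    obtain ⟨c, hc⟩ := exists_fresh (A ∪ P.fn)
    simp only [Finset.mem_union, not_or] at hc
    exact ⟨c, hc⟩
  have hbP : ∀ x ∈ P.fn, σ x ≠ b := fun x hx e => hb (Tm.mem_fn_subst.2 ⟨x, hx, e⟩)
  have orig : ∀ {c x : Name}, Function.update σ c b x ≠ b → x ≠ c := by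
    rintro c x h rfl
    exact h (by simp)
  have nu_eq : ∀ {c : Name} (Q : Proc) (B : Finset Name), (∀ x ∈ B, x ≠ c → σ x ≠ b) →
      (∀ x ∈ Q.fn, x ∈ (P.inst c).fn ∨ x ∈ B) →
      (nu c Q).subst σ = nu b (Q.subst (Function.update σ c b)) := by
    intro c Q B hB hQ
    refine nu_subst fun x hx hxc => ?_
    rcases hQ x hx with h | h
    · exact hbP x ((Tm.mem_fn_inst h).resolve_right hxc)
    · exact hB x h hxc
  cases μ with
  | tau =>
    intro A
    obtain ⟨c, -, hc⟩ := fresh ∅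
    have hbinst : ∀ x ∈ (P.inst c).fn, x ≠ c → σ x ≠ b := fun x hx hxc =>
      hbP x ((Tm.mem_fn_inst hx).resolve_right hxc)
    -- Only `c` is sent to `b` among the free names of the body, so the restricted name is never
    -- aliased: two distinct channels identified by the updated renaming avoid `c` and are already
    -- identified by `σ`.
    have hne : ∀ {a e : Name}, a ∈ (P.inst c).fn → e ∈ (P.inst c).fn → a ≠ e →
        Function.update σ c b a = Function.update σ c b e → a ≠ c ∧ e ≠ c ∧ σ a = σ e := by
      intro a e ha he hae h
      by_cases hac : a = c
      · subst hac
        rw [Function.update_self, Function.update_of_ne hae.symm] at h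
        exact absurd h.symm (hbinst e he hae.symm)
      · by_cases hec : e = c
        · subst hec
          rw [Function.update_self, Function.update_of_ne hae] at h
          exact absurd h (hbinst a ha hae)
        · rw [Function.update_of_ne hac, Function.update_of_ne hec] at h
          exact ⟨hac, hec, h⟩
    have hres : nu c (P.inst c) = .res P := nu_inst hc
    rw [← hres]
    cases h c hc (A ∪ {c}) with
    | @tau P' h e =>
      refine .tau (h.nu (by simp [Label.names])) ?_
      rw [nu_eq P' ∅ (by simp) (fun x hx => .inl (h.fn_tau hx)), e]
    | @comm a d e P₁ P₂ hae he h₁ h₂ hX =>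
      have heP : e ∈ (P.inst c).fn := (h₁.mem_fn h₂.inp_mem).elim id fun h => by
        simp only [Label.names, Finset.mem_insert, Finset.mem_singleton] at h
        rcases h with rfl | rfl
        · exact h₁.out_mem.1
        · exact h₁.out_mem.2
      have hP₂ : ∀ x ∈ P₂.fn, x ∈ (P.inst c).fn := by
        have hn₁ : ∀ x ∈ (Label.out a d).names, x ∈ (P.inst c).fn := fun x hx =>
          h₁.origin_mem hx
        intro x hx
        rcases h₂.mem_fn hx with h | h
        · exact (h₁.mem_fn h).elim id (hn₁ x)
        · simp only [Label.names, Finset.mem_insert, Finset.mem_singleton] at h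
          rcases h with rfl | rfl
          · exact heP
          · exact h₁.out_mem.2
      obtain ⟨hac, hec, hae'⟩ := hne h₁.out_mem.1 heP hae he
      have hXeq := nu_eq P₂ ∅ (by simp) (fun x hx => .inl (hP₂ x hx))
      -- If the transmitted name is the restricted one, the free output becomes a bound output under
      -- the restriction, and an aliased `comm` turns into an aliased `close`. The name `d'` is
      -- chosen to respect `A`.
      by_cases hdc : d = c
      · subst hdc
        have hdA : ∃ d', d' ∉ A ∧ d' ∉ (P.inst d).fn := by
          obtain ⟨d', hd'⟩ := exists_fresh (A ∪ (P.inst d).fn)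
          simp only [Finset.mem_union, not_or] at hd'
          exact ⟨d', hd'⟩
        obtain ⟨d', hdA, hdP⟩ := hdA
        have hdd : d' ≠ d := by rintro rfl; exact hdP h₁.out_mem.2
        have had : a ≠ d' := by rintro rfl; exact hdP h₁.out_mem.1
        have hed : e ≠ d' := by rintro rfl; exact hdP heP
        have s₁ : Step (nu d (P.inst d)) (.bout a d') (P₁.subst (Equiv.swap d d')) :=
          (h₁.nu_open hac.symm).bout_rename fun h => hdP (mem_fn_nu.1 h).1
        have s₂ := h₂.perm (Equiv.swap d d')
        rw [Label.subst, Equiv.swap_apply_left, Equiv.swap_apply_of_ne_of_ne hec hed] at s₂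
        refine .close hae hae' hdA (mem_fn_nu.2 ⟨heP, hec⟩) s₁ s₂ ?_
        rw [← nu_swap (a := d) fun h => hdP (hP₂ _ (mem_fn_nu.1 h).1), hXeq]
        exact .nu _ hX
      · refine .comm hae hae' (h₁.nu ?_) (h₂.nu ?_) (hXeq ▸ .nu _ hX)
        · simp [Label.names, Ne.symm hac, Ne.symm hdc]
        · simp [Label.names, Ne.symm hec, Ne.symm hdc]
    | @close a e d P₁ P₂ hae he hd heP h₁ h₂ hX =>
      simp only [Finset.mem_union, Finset.mem_singleton, not_or] at hd
      obtain ⟨hdA, hdc⟩ := hd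
      obtain ⟨hac, hec, hae'⟩ := hne h₁.bout_mem.1 heP hae he
      refine .close hae hae' hdA (mem_fn_nu.2 ⟨heP, hec⟩) (h₁.nu ?_) (h₂.nu ?_) ?_
      · simp [Label.names, Ne.symm hac, Ne.symm hdc]
      · simp [Label.names, Ne.symm hec, Ne.symm hdc]
      · refine (StructCong.nu _ hX).trans ?_
        rw [← nu_eq (nu d P₂) ∅ (by simp)]
        · exact (StructCong.nu_comm _ _ _).subst σ
        · intro x hx
          obtain ⟨hx, hxd⟩ := mem_fn_nu.1 hx
          refine .inl ((h₂.mem_fn hx).elim (fun h => (h₁.mem_fn h).elim id fun h => ?_)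
            fun h => ?_)
          · simp only [Label.names, Finset.mem_insert, Finset.mem_singleton, hxd,
              or_false] at h
            exact h ▸ h₁.bout_mem.1
          · simp only [Label.names, Finset.mem_insert, Finset.mem_singleton, hxd,
              or_false] at h
            exact h ▸ heP
  | out a d =>
    obtain ⟨c, -, hc⟩ := fresh ∅
    obtain ⟨a', d', P', rfl, rfl, h, e⟩ := h c hc
    simp only [Label.names, Finset.mem_insert, Finset.mem_singleton, not_or] at hbμ
    have ha := orig (Ne.symm hbμ.1)
    have hd := orig (Ne.symm hbμ.2)
    rw [Function.update_of_ne ha, Function.update_of_ne hd]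
    refine ⟨a', d', nu c P', rfl, rfl, ?_, ?_⟩
    · rw [← nu_inst hc]
      exact h.nu (by simp [Label.names, Ne.symm ha, Ne.symm hd])
    · rw [nu_eq P' ∅ (by simp) (fun x hx => .inl ((h.mem_fn hx).elim id h.origin_mem)), e]
  | inp a d =>
    intro d' hd'
    obtain ⟨c, hcd, hc⟩ := fresh {d'}
    simp only [Finset.mem_singleton] at hcd
    obtain ⟨a', P', rfl, h, e⟩ := h c hc d' (by rw [Function.update_of_ne (Ne.symm hcd), hd'])
    simp only [Label.names, Finset.mem_insert, Finset.mem_singleton, not_or] at hbμ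
    have ha := orig (Ne.symm hbμ.1)
    rw [Function.update_of_ne ha]
    refine ⟨a', nu c P', rfl, ?_, ?_⟩
    · rw [← nu_inst hc]
      exact h.nu (by simp [Label.names, Ne.symm ha, hcd])
    · rw [nu_eq P' {d'} ?_ ?_, e]
      · intro x hx _
        rw [Finset.mem_singleton.1 hx, hd']
        exact Ne.symm hbμ.2
      · intro x hx
        refine (h.mem_fn hx).elim .inl fun h' => ?_
        simp only [Label.names, Finset.mem_insert, Finset.mem_singleton] at h'
        rcases h' with rfl | rfl
        · exact .inl h.inp_mem
        · exact .inr (Finset.mem_singleton_self _)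
  | bout a d =>
    intro d' hdP hd'
    obtain ⟨c, hcd, hc⟩ := fresh {d'}
    simp only [Finset.mem_singleton] at hcd
    obtain ⟨a', P', rfl, h, e⟩ := h c hc d'
      (fun h => (Tm.mem_fn_inst h).elim hdP (Ne.symm hcd))
      (by rw [Function.update_of_ne (Ne.symm hcd), hd'])
    simp only [Label.names, Finset.mem_insert, Finset.mem_singleton, not_or] at hbμ
    have ha := orig (Ne.symm hbμ.1)
    rw [Function.update_of_ne ha]
    refine ⟨a', nu c P', rfl, ?_, ?_⟩
    · rw [← nu_inst hc]
      exact h.nu (by simp [Label.names, Ne.symm ha, hcd])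
    · rw [nu_eq P' {d'} ?_ ?_, e]
      · intro x hx _
        rw [Finset.mem_singleton.1 hx, hd']
        exact Ne.symm hbμ.2
      · intro x hx
        refine (h.mem_fn hx).elim .inl fun h' => ?_
        simp only [Label.names, Finset.mem_insert, Finset.mem_singleton] at h'
        rcases h' with rfl | rfl
        · exact .inl h.bout_mem.1
        · exact .inr (Finset.mem_singleton_self _)

/-- An output and an input in parallel components can be performed one after the other. If their
channels already coincide before renaming, this is a genuine communication; otherwise it is an
aliased one. -/
theorem SubstInv.of_comm {R P P₁ P₂ : Proc} {σ : Name → Name} {a a' b : Name}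
    (ha : σ a = σ a') (h₁ : Step R (.out a b) P₁) (h₂ : Step P₁ (.inp a' b) P₂)
    (h : a = a' → Step R .tau P₂) (hX : P₂.subst σ = P) : SubstInv R σ .tau P := by
  subst hX
  intro A
  by_cases haa : a = a'
  · exact .tau (h haa) rfl
  · exact .comm haa ha h₁ h₂ (.refl _)

/-- A transition of `Pσ` comes from `P`. -/
theorem Step.substInv {Y : Proc} {μ : Label} {X : Proc} (h : Step Y μ X) :
    ∀ {P : Proc} {σ : Name → Name}, P.subst σ = Y → SubstInv P σ μ X := by
  induction h with
  | inp a c Q =>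
    intro P σ hP b' hb'
    obtain ⟨G, rfl, hG⟩ := exists_guard_of_subst_eq hP
    obtain ⟨a', B, rfl, ha, hB⟩ := exists_inp_of_subst_eq hG
    refine ⟨a', _, ha, .inp _ _ _, ?_⟩
    rw [Tm.inst_subst, hB, hb']
  | out a b Q =>
    intro P σ hP
    obtain ⟨G, rfl, hG⟩ := exists_guard_of_subst_eq hP
    obtain ⟨a', b', B, rfl, ha, hb, hB⟩ := exists_out_of_subst_eq hG
    exact ⟨a', b', B, ha, hb, .out _ _ _, hB⟩
  | tau Q =>
    intro P σ hP A
    obtain ⟨G, rfl, hG⟩ := exists_guard_of_subst_eq hP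
    obtain ⟨B, rfl, hB⟩ := exists_tau_of_subst_eq hG
    exact .tau (.tau _) hB
  | sumL _ ih =>
    intro P σ hP
    obtain ⟨G, rfl, hG⟩ := exists_guard_of_subst_eq hP
    obtain ⟨G₁, G₂, rfl, h₁, h₂⟩ := exists_plus_of_subst_eq hG
    exact (ih (P := .ofGuard G₁) (congrArg Tm.ofGuard h₁)).mono Finset.subset_union_left
      fun _ _ h => .sumL h
  | sumR _ ih =>
    intro P σ hP
    obtain ⟨G, rfl, hG⟩ := exists_guard_of_subst_eq hP
    obtain ⟨G₁, G₂, rfl, h₁, h₂⟩ := exists_plus_of_subst_eq hG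
    exact (ih (P := .ofGuard G₂) (congrArg Tm.ofGuard h₂)).mono Finset.subset_union_right
      fun _ _ h => .sumR h
  | rep _ ih =>
    intro P σ hP
    obtain ⟨H, rfl, rfl⟩ := exists_rep_of_subst_eq hP
    exact (ih (P := .par (.rep H) (.ofGuard H)) rfl).mono (by simp [Tm.fn])
      fun _ _ h => .rep h
  | @opn Q a b X hb hba _ ih =>
    intro P σ hP b' hb' hσb
    obtain ⟨B, rfl, rfl⟩ := exists_res_of_subst_eq hP
    have hne : ∀ x ∈ B.fn, σ x ≠ b := fun x hx e => hb (Tm.mem_fn_subst.2 ⟨x, hx, e⟩)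
    obtain ⟨a', b'', X', rfl, hb'', h, rfl⟩ :=
      @ih (B.inst b') σ (by rw [Tm.inst_subst, hσb])
    -- The name `b` is fresh for the renamed body, so among the free names of the instance it has
    -- only the preimage `b'`.
    have : b'' = b' := (Tm.mem_fn_inst h.out_mem.2).resolve_left fun h => hne b'' h hb''
    subst this
    exact ⟨a', X', rfl, .opn hb' (by rintro rfl; exact hba hσb.symm) h, rfl⟩
  | @res Q b μ X hb hbμ h ih =>
    intro P σ hP
    obtain ⟨B, rfl, rfl⟩ := exists_res_of_subst_eq hP
    refine SubstInv.res hb hbμ fun c hc => ih ?_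
    rw [Tm.inst_subst, Tm.subst_update hc, Function.update_self]
  | parL _ _ ih =>
    intro P σ hP
    obtain ⟨P₁, P₂, rfl, rfl, rfl⟩ := exists_par_of_subst_eq hP
    exact (ih rfl).parL
  | parR _ _ ih =>
    intro P σ hP
    obtain ⟨P₁, P₂, rfl, rfl, rfl⟩ := exists_par_of_subst_eq hP
    exact (ih rfl).parR
  | commL _ _ ih₁ ih₂ =>
    intro P σ hP
    obtain ⟨P₁, P₂, rfl, rfl, rfl⟩ := exists_par_of_subst_eq hP
    obtain ⟨a₂, b₂, Q', rfl, hb, h₂, rfl⟩ := ih₂ (P := P₂) rfl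
    obtain ⟨a₁, P', ha, h₁, rfl⟩ := ih₁ (P := P₁) rfl b₂ hb
    exact .of_comm ha.symm (.parR (by simp [Label.bn]) h₂) (.parL (by simp [Label.bn]) h₁)
      (fun e => .commL h₁ (e ▸ h₂)) rfl
  | commR _ _ ih₁ ih₂ =>
    intro P σ hP
    obtain ⟨P₁, P₂, rfl, rfl, rfl⟩ := exists_par_of_subst_eq hP
    obtain ⟨a₁, b₁, P', rfl, hb, h₁, rfl⟩ := ih₁ (P := P₁) rfl
    obtain ⟨a₂, Q', ha, h₂, rfl⟩ := ih₂ (P := P₂) rfl b₁ hb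
    exact .of_comm ha.symm (.parL (by simp [Label.bn]) h₁) (.parR (by simp [Label.bn]) h₂)
      (fun e => .commR h₁ (e ▸ h₂)) rfl
  | @closeL _ _ X Y a b hb hs₁ hs₂ ih₁ ih₂ =>
    intro P σ hP A
    obtain ⟨P₁, P₂, rfl, rfl, rfl⟩ := exists_par_of_subst_eq hP
    -- The extruded name `b` need not be in the range of `σ`. Sending a fresh `d` to `b` leaves both
    -- components unchanged and supplies a common preimage for the input and the bound output.
    obtain ⟨d, hd⟩ := exists_fresh (A ∪ P₁.fn ∪ P₂.fn)
    simp only [Finset.mem_union, not_or] at hd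
    obtain ⟨⟨hdA, hd₁⟩, hd₂⟩ := hd
    obtain ⟨a₁, P', ha₁, h₁, rfl⟩ :=
      ih₁ (P := P₁) (Tm.subst_update hd₁) d (Function.update_self _ _ _)
    obtain ⟨a₂, Q', ha₂, h₂, rfl⟩ :=
      ih₂ (P := P₂) (Tm.subst_update hd₂) d hd₂ (Function.update_self _ _ _)
    rw [update_of_notMem hd₁ _ h₁.inp_mem] at ha₁
    rw [update_of_notMem hd₂ _ h₂.bout_mem.1] at ha₂
    have key : (PiCalc.nu d (.par P' Q')).subst σ = PiCalc.nu b (.par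
        (P'.subst (Function.update σ d b)) (Q'.subst (Function.update σ d b))) := by
      refine nu_subst fun x hx hxd e => ?_
      rcases Finset.mem_union.1 hx with hx | hx
      · refine hb (Tm.mem_fn_subst.2 ⟨x, (h₁.mem_fn hx).elim id fun h => ?_, e⟩)
        simp only [Label.names, Finset.mem_insert, Finset.mem_singleton, hxd, or_false] at h
        exact h ▸ h₁.inp_mem
      · refine hs₂.bout_mem.2 (Tm.mem_fn_subst.2 ⟨x, (h₂.mem_fn hx).elim id fun h => ?_, e⟩)
        simp only [Label.names, Finset.mem_insert, Finset.mem_singleton, hxd, or_false] at h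
        exact h ▸ h₂.bout_mem.1
    by_cases haa : a₂ = a₁
    · subst haa
      exact .tau (.closeL hd₁ h₁ h₂) key
    · exact .close haa (ha₂.trans ha₁.symm) hdA (Finset.mem_union_left _ h₁.inp_mem)
        (.parR (by simpa [Label.bn] using hd₁) h₂) (.parL (by simp [Label.bn]) h₁)
        (key ▸ .refl _)
  | @closeR _ _ X Y a b hb hs₁ hs₂ ih₁ ih₂ =>
    intro P σ hP A
    obtain ⟨P₁, P₂, rfl, rfl, rfl⟩ := exists_par_of_subst_eq hP
    obtain ⟨d, hd⟩ := exists_fresh (A ∪ P₁.fn ∪ P₂.fn)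
    simp only [Finset.mem_union, not_or] at hd
    obtain ⟨⟨hdA, hd₁⟩, hd₂⟩ := hd
    obtain ⟨a₂, Q', ha₂, h₂, rfl⟩ :=
      ih₂ (P := P₂) (Tm.subst_update hd₂) d (Function.update_self _ _ _)
    obtain ⟨a₁, P', ha₁, h₁, rfl⟩ :=
      ih₁ (P := P₁) (Tm.subst_update hd₁) d hd₁ (Function.update_self _ _ _)
    rw [update_of_notMem hd₂ _ h₂.inp_mem] at ha₂
    rw [update_of_notMem hd₁ _ h₁.bout_mem.1] at ha₁
    have key : (PiCalc.nu d (.par P' Q')).subst σ = PiCalc.nu b (.par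
        (P'.subst (Function.update σ d b)) (Q'.subst (Function.update σ d b))) := by
      refine nu_subst fun x hx hxd e => ?_
      rcases Finset.mem_union.1 hx with hx | hx
      · refine hs₁.bout_mem.2 (Tm.mem_fn_subst.2 ⟨x, (h₁.mem_fn hx).elim id fun h => ?_, e⟩)
        simp only [Label.names, Finset.mem_insert, Finset.mem_singleton, hxd, or_false] at h
        exact h ▸ h₁.bout_mem.1
      · refine hb (Tm.mem_fn_subst.2 ⟨x, (h₂.mem_fn hx).elim id fun h => ?_, e⟩)
        simp only [Label.names, Finset.mem_insert, Finset.mem_singleton, hxd, or_false] at h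
        exact h ▸ h₂.inp_mem
    by_cases haa : a₁ = a₂
    · subst haa
      exact .tau (.closeR hd₂ h₁ h₂) key
    · exact .close haa (ha₁.trans ha₂.symm) hdA (Finset.mem_union_right _ h₂.inp_mem)
        (.parL (by simpa [Label.bn] using hd₂) h₁) (.parR (by simp [Label.bn]) h₂)
        (key ▸ .refl _)

/-! ## Weak transitions -/

theorem TauStar.fn_subset {P P' : Proc} (h : TauStar P P') : P'.fn ⊆ P.fn := by
  induction h with
  | refl => rfl
  | tail _ h ih => exact h.fn_tau.trans ih

theorem TauStar.lift {f : Proc → Proc} (hf : ∀ P P', Step P .tau P' → Step (f P) .tau (f P'))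
    {P P' : Proc} (h : TauStar P P') : TauStar (f P) (f P') := by
  induction h with
  | refl => exact .refl
  | tail _ h ih => exact ih.tail (hf _ _ h)

theorem TauStar.subst {P P' : Proc} (h : TauStar P P') (σ : Name → Name) :
    TauStar (P.subst σ) (P'.subst σ) :=
  TauStar.lift (f := Tm.subst σ) (fun _ _ h => h.subst σ (by simp [Label.bn])) h

theorem TauStar.nu {P P' : Proc} (h : TauStar P P') (a : Name) :
    TauStar (nu a P) (PiCalc.nu a P') :=
  TauStar.lift (fun _ _ h => h.nu (by simp [Label.names])) h

theorem TauStar.par {P P' Q Q' : Proc} (hP : TauStar P P') (hQ : TauStar Q Q') :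
    TauStar (.par P Q) (.par P' Q') :=
  Relation.ReflTransGen.trans
    (TauStar.lift (f := fun X => Tm.par X Q) (fun _ _ h => .parL (by simp [Label.bn]) h) hP)
    (TauStar.lift (f := Tm.par P') (fun _ _ h => .parR (by simp [Label.bn]) h) hQ)

theorem TauStar.trans_step {P P₁ P₂ P' : Proc} (h₁ : TauStar P P₁) (h : Step P₁ .tau P₂)
    (h₂ : TauStar P₂ P') : TauStar P P' :=
  Relation.ReflTransGen.trans h₁ (Relation.ReflTransGen.head h h₂)

theorem WStep.subst {P P' : Proc} {μ : Label} (h : WStep P μ P') (σ : Name → Name)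
    (hσ : ∀ b ∈ μ.bn, ∀ x ∈ P.fn, σ x ≠ σ b) : WStep (P.subst σ) (μ.subst σ) (P'.subst σ) := by
  obtain ⟨P₁, P₂, h₁, h, h₂⟩ := h
  exact ⟨_, _, h₁.subst σ, h.subst σ fun b hb x hx => hσ b hb x (h₁.fn_subset hx), h₂.subst σ⟩

theorem WStep.perm {P P' : Proc} {μ : Label} (h : WStep P μ P') (π : Equiv.Perm Name) :
    WStep (P.subst π) (μ.subst π) (P'.subst π) := by
  obtain ⟨P₁, P₂, h₁, h, h₂⟩ := h
  exact ⟨_, _, h₁.subst π, h.perm π, h₂.subst π⟩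

theorem WStep.nu {P P' : Proc} {μ : Label} {c : Name} (h : WStep P μ P') (hc : c ∉ μ.names) :
    WStep (nu c P) μ (PiCalc.nu c P') := by
  obtain ⟨P₁, P₂, h₁, h, h₂⟩ := h
  exact ⟨_, _, h₁.nu c, h.nu hc, h₂.nu c⟩

theorem WStep.nu_open {P P' : Proc} {a c : Name} (h : WStep P (.out a c) P') (hc : c ≠ a) :
    WStep (PiCalc.nu c P) (.bout a c) P' := by
  obtain ⟨P₁, P₂, h₁, h, h₂⟩ := h
  exact ⟨_, _, h₁.nu c, h.nu_open hc, h₂⟩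

theorem WStep.parL {P P' : Proc} {μ : Label} (h : WStep P μ P') {Q : Proc}
    (hd : Disjoint μ.bn Q.fn) : WStep (.par P Q) μ (.par P' Q) := by
  obtain ⟨P₁, P₂, h₁, h, h₂⟩ := h
  exact ⟨_, _, h₁.par .refl, h.parL hd, h₂.par .refl⟩

theorem WStep.parR {Q Q' : Proc} {μ : Label} (h : WStep Q μ Q') {P : Proc}
    (hd : Disjoint μ.bn P.fn) : WStep (.par P Q) μ (.par P Q') := by
  obtain ⟨P₁, P₂, h₁, h, h₂⟩ := h
  exact ⟨_, _, .par .refl h₁, h.parR hd, .par .refl h₂⟩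

theorem WStep.commL {P P' Q Q' : Proc} {a b : Name} (hP : WStep P (.inp a b) P')
    (hQ : WStep Q (.out a b) Q') : TauStar (.par P Q) (.par P' Q') := by
  obtain ⟨P₁, P₂, h₁, h, h₂⟩ := hP
  obtain ⟨Q₁, Q₂, k₁, k, k₂⟩ := hQ
  exact (h₁.par k₁).trans_step (.commL h k) (h₂.par k₂)

theorem WStep.commR {P P' Q Q' : Proc} {a b : Name} (hP : WStep P (.out a b) P')
    (hQ : WStep Q (.inp a b) Q') : TauStar (.par P Q) (.par P' Q') := by
  obtain ⟨P₁, P₂, h₁, h, h₂⟩ := hP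
  obtain ⟨Q₁, Q₂, k₁, k, k₂⟩ := hQ
  exact (h₁.par k₁).trans_step (.commR h k) (h₂.par k₂)

theorem WStep.closeL {P P' Q Q' : Proc} {a b : Name} (hb : b ∉ P.fn)
    (hP : WStep P (.inp a b) P') (hQ : WStep Q (.bout a b) Q') :
    TauStar (.par P Q) (PiCalc.nu b (.par P' Q')) := by
  obtain ⟨P₁, P₂, h₁, h, h₂⟩ := hP
  obtain ⟨Q₁, Q₂, k₁, k, k₂⟩ := hQ
  exact (h₁.par k₁).trans_step (.closeL (fun h => hb (h₁.fn_subset h)) h k) ((h₂.par k₂).nu b)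

theorem WStep.closeR {P P' Q Q' : Proc} {a b : Name} (hb : b ∉ Q.fn)
    (hP : WStep P (.bout a b) P') (hQ : WStep Q (.inp a b) Q') :
    TauStar (.par P Q) (PiCalc.nu b (.par P' Q')) := by
  obtain ⟨P₁, P₂, h₁, h, h₂⟩ := hP
  obtain ⟨Q₁, Q₂, k₁, k, k₂⟩ := hQ
  exact (h₁.par k₁).trans_step (.closeR (fun h => hb (k₁.fn_subset h)) h k) ((h₂.par k₂).nu b)

theorem wStepHat_iff {P P' : Proc} {μ : Label} (hμ : μ ≠ .tau) :
    WStepHat P μ P' ↔ WStep P μ P' := by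
  cases μ <;> first | exact Iff.rfl | exact absurd rfl hμ

theorem stepHat_iff {P P' : Proc} {μ : Label} (hμ : μ ≠ .tau) :
    StepHat P μ P' ↔ Step P μ P' := by
  cases μ <;> first | exact Iff.rfl | exact absurd rfl hμ

theorem Step.stepHat {P P' : Proc} {μ : Label} (h : Step P μ P') : StepHat P μ P' := by
  cases μ <;> first | exact h | exact .inr h

theorem Step.wStepHat {P P' : Proc} {μ : Label} (h : Step P μ P') : WStepHat P μ P' := by
  cases μ with
  | tau => exact Relation.ReflTransGen.single h
  | _ => exact ⟨_, _, .refl, h, .refl⟩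

theorem ClosedUnderTransitions.tauStar {S : Set Proc} (hS : ClosedUnderTransitions S)
    {P P' : Proc} (hP : P ∈ S) (h : TauStar P P') : P' ∈ S := by
  induction h with
  | refl => exact hP
  | tail _ h ih => exact hS _ ih _ _ h

theorem ClosedUnderTransitions.wStep {S : Set Proc} (hS : ClosedUnderTransitions S)
    {P P' : Proc} {μ : Label} (hP : P ∈ S) (h : WStep P μ P') : P' ∈ S := by
  obtain ⟨P₁, P₂, h₁, h, h₂⟩ := h
  exact hS.tauStar (hS _ (hS.tauStar hP h₁) _ _ h) h₂

theorem ClosedUnderTransitions.wStepHat {S : Set Proc} (hS : ClosedUnderTransitions S)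
    {P P' : Proc} {μ : Label} (hP : P ∈ S) (h : WStepHat P μ P') : P' ∈ S := by
  by_cases hμ : μ = .tau
  · subst hμ; exact hS.tauStar hP h
  · exact hS.wStep hP ((wStepHat_iff hμ).1 h)

/-! ## Expansion -/

theorem Expands.unfold {P Q : Proc} (h : Expands P Q) :
    sHat Expands P Q ∧ ws (flip Expands) Q P := by
  obtain ⟨R, hR, h⟩ := h
  refine ⟨fun μ P' hd hs => ?_, fun μ Q' hd hs => ?_⟩
  · obtain ⟨Q', hQ, hR'⟩ := (hR _ _ h).1 μ P' hd hs
    exact ⟨Q', hQ, R, hR, hR'⟩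
  · obtain ⟨P', hP, hR'⟩ := (hR _ _ h).2 μ Q' hd hs
    exact ⟨P', hP, R, hR, hR'⟩

/-- A strong bisimulation is an expansion; this is how up-to-expansion subsumes up-to-`≡` below. -/
theorem StructCong.expands {P Q : Proc} (h : StructCong P Q) : Expands P Q := by
  refine ⟨fun P Q => StructCong P Q, fun P Q h => ⟨fun μ P' _ hs => ?_, fun μ Q' _ hs => ?_⟩, h⟩
  · obtain ⟨Q', hs, c⟩ := h.strongSim.1 μ P' hs
    exact ⟨Q', hs.stepHat, c⟩
  · obtain ⟨P', hs, c⟩ := h.strongSim.2 μ Q' hs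
    exact ⟨P', hs.wStepHat, c.symm⟩

theorem Expands.tauStar {P Q Q' : Proc} (h : Expands P Q) (hQ : TauStar Q Q') :
    ∃ P', TauStar P P' ∧ Expands P' Q' := by
  induction hQ with
  | refl => exact ⟨P, .refl, h⟩
  | tail _ hs ih =>
    obtain ⟨P₁, h₁, e⟩ := ih
    obtain ⟨P', h₂, e'⟩ := e.unfold.2 _ _ (by simp [Label.bn]) hs
    exact ⟨P', Relation.ReflTransGen.trans h₁ h₂, e'⟩

theorem Expands.wStep {P Q Q' : Proc} {μ : Label} (h : Expands P Q) (hμ : μ ≠ .tau)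
    (hd : Disjoint μ.bn P.fn) (hQ : WStep Q μ Q') : ∃ P', WStep P μ P' ∧ Expands P' Q' := by
  obtain ⟨Q₁, Q₂, h₁, hs, h₂⟩ := hQ
  obtain ⟨P₁, k₁, e₁⟩ := h.tauStar h₁
  obtain ⟨P₂, k, e₂⟩ := e₁.unfold.2 _ _ (hd.mono_right k₁.fn_subset) hs
  obtain ⟨P₃, P₄, m₁, m, m₂⟩ := (wStepHat_iff hμ).1 k
  obtain ⟨P', k₂, e₃⟩ := Expands.tauStar e₂ h₂
  exact ⟨P', ⟨P₃, P₄, Relation.ReflTransGen.trans k₁ m₁, m,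
    Relation.ReflTransGen.trans m₂ k₂⟩, e₃⟩

/-! ## Closure under the up-to techniques -/

/-- Closure of a relation under the up-to techniques. Renamings that are not injective are applied
to processes of `S` only; `prog` covers guarded sums. -/
inductive Closure (S : Set Proc) (R : BinRel Proc) : Proc → Proc → Prop
  | base {P Q : Proc} : R P Q → Closure S R P Q
  | exp {P P₀ Q₀ Q : Proc} :
      Expands P P₀ → Closure S R P₀ Q₀ → Expands Q Q₀ → Closure S R P Q
  | refl (P : Proc) : Closure S R P P
  | sub (σ : Name → Name) {P Q : Proc} :
      P ∈ S → Q ∈ S → Closure S R P Q → Closure S R (P.subst σ) (Q.subst σ)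
  | perm (π : Equiv.Perm Name) {P Q : Proc} :
      Closure S R P Q → Closure S R (P.subst π) (Q.subst π)
  | nu (a : Name) {P Q : Proc} : Closure S R P Q → Closure S R (nu a P) (nu a Q)
  | par {P Q P' Q' : Proc} :
      Closure S R P Q → Closure S R P' Q' → Closure S R (.par P P') (.par Q Q')
  | rep {G H : Guard} :
      Closure S R (.ofGuard G) (.ofGuard H) → Closure S R (.rep G) (.rep H)
  | prog {P Q : Proc} (f g : Label → Proc → Proc) :
      (∀ μ P', Step P μ P' → Step Q μ (f μ P')) →
      (∀ μ P', Step P μ P' → Closure S R P' (f μ P')) →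
      (∀ μ Q', Step Q μ Q' → Step P μ (g μ Q')) →
      (∀ μ Q', Step Q μ Q' → Closure S R (g μ Q') Q') → Closure S R P Q

section Closure

variable {S : Set Proc} {R : BinRel Proc}

theorem Closure.symm (hR : ∀ P Q, R P Q → R Q P) {P Q : Proc} (h : Closure S R P Q) :
    Closure S R Q P := by
  induction h with
  | base h => exact .base (hR _ _ h)
  | exp h₁ _ h₂ ih => exact .exp h₂ ih h₁
  | refl P => exact .refl P
  | sub σ hP hQ _ ih => exact .sub σ hQ hP ih
  | perm π _ ih => exact .perm π ih
  | nu a _ ih => exact .nu a ih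
  | par _ _ ih₁ ih₂ => exact .par ih₁ ih₂
  | rep _ ih => exact .rep ih
  | prog f g hf _ hg _ ihf ihg => exact .prog g f hg ihg hf ihf

/-- The constructor `prog` takes the matching derivatives as functions; choice supplies them from
existence. -/
theorem Closure.of_progress {P Q : Proc}
    (hP : ∀ μ P', Step P μ P' → ∃ Q', Step Q μ Q' ∧ Closure S R P' Q')
    (hQ : ∀ μ Q', Step Q μ Q' → ∃ P', Step P μ P' ∧ Closure S R P' Q') : Closure S R P Q := by
  classical
  refine .prog (fun μ P' => if h : Step P μ P' then (hP μ P' h).choose else P')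
    (fun μ Q' => if h : Step Q μ Q' then (hQ μ Q' h).choose else Q') ?_ ?_ ?_ ?_
  · intro μ P' h
    simpa only [h, dif_pos] using (hP μ P' h).choose_spec.1
  · intro μ P' h
    simpa only [h, dif_pos] using (hP μ P' h).choose_spec.2
  · intro μ Q' h
    simpa only [h, dif_pos] using (hQ μ Q' h).choose_spec.1
  · intro μ Q' h
    simpa only [h, dif_pos] using (hQ μ Q' h).choose_spec.2

/-- `Q` matches the visible transitions of `P`. -/
def VisibleSim (T : BinRel Proc) (P Q : Proc) : Prop :=
  ∀ μ P', μ ≠ .tau → Disjoint μ.bn Q.fn → Step P μ P' → ∃ Q', WStep Q μ Q' ∧ T P' Q'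

/-- `Q` matches the silent transitions of `P`. -/
def SilentSim (T : BinRel Proc) (P Q : Proc) : Prop :=
  ∀ P', Step P .tau P' → ∃ Q', TauStar Q Q' ∧ T P' Q'

theorem ws_iff {T : BinRel Proc} {P Q : Proc} :
    ws T P Q ↔ VisibleSim T P Q ∧ SilentSim T P Q := by
  refine ⟨fun h => ⟨fun μ P' hμ hd hs => ?_, fun P' hs => h .tau P' (by simp [Label.bn]) hs⟩,
    fun h μ P' hd hs => ?_⟩
  · obtain ⟨Q', hQ, hT⟩ := h μ P' hd hs
    exact ⟨Q', (wStepHat_iff hμ).1 hQ, hT⟩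
  · by_cases hμ : μ = .tau
    · subst hμ; exact h.2 P' hs
    · obtain ⟨Q', hQ, hT⟩ := h.1 μ P' hμ hd hs
      exact ⟨Q', (wStepHat_iff hμ).2 hQ, hT⟩

/-! ### Matching visible transitions in the closure. -/

theorem VisibleSim.perm {P Q : Proc} (h : VisibleSim (Closure S R) P Q) (π : Equiv.Perm Name) :
    VisibleSim (Closure S R) (P.subst π) (Q.subst π) := by
  intro μ P' hμ hd hs
  have hs' := hs.perm π.symm
  rw [subst_perm_symm] at hs'
  have hμ' : μ.subst π.symm ≠ .tau := by cases μ <;> simp_all [Label.subst]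
  have hd' : Disjoint (μ.subst π.symm).bn Q.fn := by
    refine Finset.disjoint_left.2 fun x hx hxQ => ?_
    obtain ⟨b, hb, rfl⟩ := Label.mem_bn_subst.1 hx
    exact Finset.disjoint_left.1 hd hb (Tm.mem_fn_subst.2 ⟨_, hxQ, by simp⟩)
  obtain ⟨Q', hQ, hT⟩ := h _ _ hμ' hd' hs'
  refine ⟨Q'.subst π, ?_, ?_⟩
  · simpa only [Label.subst_symm_perm] using hQ.perm π
  · simpa only [subst_symm_perm] using hT.perm π

/-- An extruded name may be assumed to avoid any finite set: match the renamed bound output and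
rename the answer back, which the closure permits by `perm`. -/
theorem VisibleSim.of_fresh {P Q : Proc} (A : Finset Name)
    (h : ∀ μ P', μ ≠ .tau → Disjoint μ.bn Q.fn → Disjoint μ.bn A → Step P μ P' →
      ∃ Q', WStep Q μ Q' ∧ Closure S R P' Q') : VisibleSim (Closure S R) P Q := by
  intro μ P' hμ hd hs
  cases μ with
  | bout a b =>
    obtain ⟨c, hc⟩ := exists_fresh (A ∪ P.fn ∪ Q.fn)
    simp only [Finset.mem_union, not_or] at hc
    obtain ⟨⟨hcA, hcP⟩, hcQ⟩ := hc
    have hbQ : b ∉ Q.fn := by simpa [Label.bn] using hd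
    obtain ⟨Q', hQ, hT⟩ := h (.bout a c) _ (by simp) (by simpa [Label.bn] using hcQ)
      (by simpa [Label.bn] using hcA) (hs.bout_rename hcP)
    have ha : Equiv.swap b c a = a := swap_of_notMem hs.bout_mem.2 hcP a hs.bout_mem.1
    have hQ' := hQ.perm (Equiv.swap b c)
    rw [Tm.subst_swap_eq_self hbQ hcQ, Label.subst, ha, Equiv.swap_apply_right] at hQ'
    refine ⟨_, hQ', ?_⟩
    have hT' := hT.perm (Equiv.swap b c).symm
    rwa [subst_perm_symm, Equiv.symm_swap] at hT'
  | _ => exact h _ P' hμ hd (by simp [Label.bn]) hs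

/-- The intermediate processes may have free names that `P` and `Q` lack, so extruded names are
first moved away from them. Since `P₀` answers a visible transition strongly, silent simulation is
not required. -/
theorem VisibleSim.exp {P P₀ Q Q₀ : Proc} (hP : Expands P P₀) (hQ : Expands Q Q₀)
    (h : VisibleSim (Closure S R) P₀ Q₀) : VisibleSim (Closure S R) P Q := by
  refine .of_fresh (P₀.fn ∪ Q₀.fn) fun μ P' hμ hd hA hs => ?_
  obtain ⟨h₁, h₂⟩ := Finset.disjoint_union_right.1 hA
  obtain ⟨P₀', hs, e⟩ := hP.unfold.1 μ P' h₁ hs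
  obtain ⟨Q₀', hs, hT⟩ := h μ P₀' hμ h₂ ((stepHat_iff hμ).1 hs)
  obtain ⟨Q', hs, e'⟩ := hQ.wStep hμ hd hs
  exact ⟨Q', hs, .exp e hT e'⟩

/-- A bound output may arise by opening the restriction. It is then matched through the free output
underneath, and opened in the same way on the other side. -/
theorem VisibleSim.nu {P Q : Proc} (h : VisibleSim (Closure S R) P Q) (a : Name) :
    VisibleSim (Closure S R) (PiCalc.nu a P) (PiCalc.nu a Q) := by
  intro μ X hμ hd hs
  obtain ⟨c, hc⟩ := exists_fresh (P.fn ∪ Q.fn ∪ μ.names)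
  simp only [Finset.mem_union, not_or] at hc
  obtain ⟨⟨hcP, hcQ⟩, hc⟩ := hc
  rw [nu_swap fun h => hcQ (mem_fn_nu.1 h).1] at hd ⊢
  rw [nu_swap fun h => hcP (mem_fn_nu.1 h).1] at hs
  have h' := h.perm (Equiv.swap a c)
  rcases hs.nu_inv hc with ⟨e, b, rfl, hb, hbe, -, -, hs'⟩ | ⟨P', hs', rfl⟩
  · obtain ⟨Y, hY, hT⟩ := h'.perm _ _ _ (by simp) (by simp [Label.bn]) hs'
    refine ⟨Y, ?_, hT⟩
    rw [nu_swap (by simpa [Label.bn] using hd)]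
    exact hY.nu_open hbe
  · obtain ⟨Y, hY, hT⟩ := h' _ _ hμ
      (Finset.disjoint_left.2 fun x hx hxQ => Finset.disjoint_left.1 hd hx
        (mem_fn_nu.2 ⟨hxQ, by rintro rfl; exact hc (Label.bn_subset_names _ hx)⟩)) hs'
    exact ⟨_, hY.nu hc, .nu _ hT⟩

theorem VisibleSim.par {P Q P' Q' : Proc} (h : Closure S R P Q) (h' : Closure S R P' Q')
    (v : VisibleSim (Closure S R) P Q) (v' : VisibleSim (Closure S R) P' Q') :
    VisibleSim (Closure S R) (.par P P') (.par Q Q') := by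
  intro μ X hμ hd hs
  obtain ⟨hd, hd'⟩ := disjoint_of_fn_par hd
  cases hs with
  | parL _ hs =>
    obtain ⟨Y, hY, hT⟩ := v _ _ hμ hd hs
    exact ⟨_, hY.parL hd', .par hT h'⟩
  | parR _ hs =>
    obtain ⟨Y, hY, hT⟩ := v' _ _ hμ hd' hs
    exact ⟨_, hY.parR hd, .par h hT⟩
  | _ => exact absurd rfl hμ

theorem VisibleSim.rep {G H : Guard} (h : Closure S R (.ofGuard G) (.ofGuard H))
    (v : VisibleSim (Closure S R) (.ofGuard G) (.ofGuard H)) :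
    VisibleSim (Closure S R) (.rep G) (.rep H) := by
  intro μ X hμ hd hs
  rcases hs.rep_inv with ⟨P₁, hs, c⟩ | ⟨rfl, -⟩
  · obtain ⟨Q₁, hQ, hT⟩ := v _ _ hμ (by simp [hs.guard_bn]) hs
    obtain ⟨Q', hQ', e⟩ := (StructCong.rep_unfold H).expands.wStep hμ hd
      (hQ.parR (P := .rep H) (by simp [hs.guard_bn]))
    exact ⟨Q', hQ', .exp c.expands (.par (.rep h) hT) e⟩
  · exact absurd rfl hμ

/-- Visible transitions of a renamed process always come from the original one, so aliasing plays no
role here. For inputs and bound outputs the object gets a preimage `b'` fresh for both processes,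
and the answer is renamed by the updated `σ`. -/
theorem VisibleSim.sub (hS : ClosedUnderTransitions S) {P Q : Proc} (hP : P ∈ S) (hQ : Q ∈ S)
    (v : VisibleSim (Closure S R) P Q) (σ : Name → Name) :
    VisibleSim (Closure S R) (P.subst σ) (Q.subst σ) := by
  intro μ X hμ hd hs
  obtain ⟨b', hb'⟩ := exists_fresh (P.fn ∪ Q.fn)
  simp only [Finset.mem_union, not_or] at hb'
  cases μ with
  | tau => exact absurd rfl hμ
  | out a b =>
    obtain ⟨a', b', P', rfl, rfl, hs', rfl⟩ := hs.substInv (P := P) rfl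
    obtain ⟨Q', hQ', hT⟩ := v _ _ (by simp) (by simp [Label.bn]) hs'
    exact ⟨_, hQ'.subst σ (by simp [Label.bn]), .sub σ (hS _ hP _ _ hs') (hS.wStep hQ hQ') hT⟩
  | inp a b =>
    obtain ⟨a', P', rfl, hs', rfl⟩ := hs.substInv (P := P)
      (σ := Function.update σ b' b) (Tm.subst_update hb'.1) b' (Function.update_self _ _ _)
    obtain ⟨Q', hQ', hT⟩ := v _ _ (by simp) (by simp [Label.bn]) hs'
    have hw := hQ'.subst (Function.update σ b' b) (by simp [Label.bn])
    rw [Tm.subst_update hb'.2, Label.subst, Function.update_self] at hw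
    exact ⟨_, hw, .sub _ (hS _ hP _ _ hs') (hS.wStep hQ hQ') hT⟩
  | bout a b =>
    obtain ⟨a', P', rfl, hs', rfl⟩ := hs.substInv (P := P)
      (σ := Function.update σ b' b) (Tm.subst_update hb'.1) b' hb'.1
      (Function.update_self _ _ _)
    obtain ⟨Q', hQ', hT⟩ := v _ _ (by simp) (by simpa [Label.bn] using hb'.2) hs'
    have hw := hQ'.subst (Function.update σ b' b) fun d hd' x hx => by
      have hdb : d = b' := by simpa [Label.bn] using hd'
      subst hdb
      rw [Function.update_self, update_of_notMem hb'.2 x hx]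
      rintro rfl
      exact (by simpa [Label.bn] using hd : σ x ∉ (Q.subst σ).fn)
        (Tm.mem_fn_subst.2 ⟨x, hx, rfl⟩)
    rw [Tm.subst_update hb'.2, Label.subst, Function.update_self] at hw
    exact ⟨_, hw, .sub _ (hS _ hP _ _ hs') (hS.wStep hQ hQ') hT⟩

theorem Closure.visibleSim (hS : ClosedUnderTransitions S)
    (hR : ∀ P Q, R P Q → ws (Closure S R) P Q) {P Q : Proc} (h : Closure S R P Q) :
    VisibleSim (Closure S R) P Q := by
  induction h with
  | base h => exact (ws_iff.1 (hR _ _ h)).1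
  | exp h₁ _ h₂ ih => exact ih.exp h₁ h₂
  | refl P => exact fun μ P' hμ _ hs => ⟨P', (wStepHat_iff hμ).1 hs.wStepHat, .refl _⟩
  | sub σ hP hQ _ ih => exact ih.sub hS hP hQ σ
  | perm π _ ih => exact ih.perm π
  | nu a _ ih => exact ih.nu a
  | par h₁ h₂ ih₁ ih₂ => exact .par h₁ h₂ ih₁ ih₂
  | rep h ih => exact .rep h ih
  | prog f g hf hf' _ _ _ _ =>
    exact fun μ P' hμ _ hs =>
      ⟨_, (wStepHat_iff hμ).1 (hf μ P' hs).wStepHat, hf' μ P' hs⟩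

/-! ### Matching silent transitions in the closure. -/

theorem SilentSim.par {P Q P' Q' : Proc} (h : Closure S R P Q) (h' : Closure S R P' Q')
    (v : VisibleSim (Closure S R) P Q) (v' : VisibleSim (Closure S R) P' Q')
    (s : SilentSim (Closure S R) P Q) (s' : SilentSim (Closure S R) P' Q') :
    SilentSim (Closure S R) (.par P P') (.par Q Q') := by
  intro X hs
  cases hs.par_inv (Q.fn ∪ Q'.fn) with
  | parL _ hs' =>
    obtain ⟨Y, hY, hT⟩ := s _ hs'
    exact ⟨_, hY.par .refl, .par hT h'⟩
  | parR _ hs' =>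
    obtain ⟨Y, hY, hT⟩ := s' _ hs'
    exact ⟨_, .par .refl hY, .par h hT⟩
  | commL h₁ h₂ =>
    obtain ⟨Y, hY, hT⟩ := v _ _ (by simp) (by simp [Label.bn]) h₁
    obtain ⟨Y', hY', hT'⟩ := v' _ _ (by simp) (by simp [Label.bn]) h₂
    exact ⟨_, hY.commL hY', .par hT hT'⟩
  | commR h₁ h₂ =>
    obtain ⟨Y, hY, hT⟩ := v _ _ (by simp) (by simp [Label.bn]) h₁
    obtain ⟨Y', hY', hT'⟩ := v' _ _ (by simp) (by simp [Label.bn]) h₂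
    exact ⟨_, hY.commR hY', .par hT hT'⟩
  | closeL hb _ _ h₁ h₂ =>
    simp only [Finset.mem_union, not_or] at hb
    obtain ⟨Y, hY, hT⟩ := v _ _ (by simp) (by simp [Label.bn]) h₁
    obtain ⟨Y', hY', hT'⟩ := v' _ _ (by simp) (by simpa [Label.bn] using hb.2) h₂
    exact ⟨_, hY.closeL hb.1 hY', .nu _ (.par hT hT')⟩
  | closeR hb _ _ h₁ h₂ =>
    simp only [Finset.mem_union, not_or] at hb
    obtain ⟨Y, hY, hT⟩ := v _ _ (by simp) (by simpa [Label.bn] using hb.1) h₁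
    obtain ⟨Y', hY', hT'⟩ := v' _ _ (by simp) (by simp [Label.bn]) h₂
    exact ⟨_, hY.closeR hb.2 hY', .nu _ (.par hT hT')⟩

/-- The answer is computed in `!H` with one or two copies of `H` unfolded, and carried back to `!H`
by expansion. -/
theorem SilentSim.rep {G H : Guard} (h : Closure S R (.ofGuard G) (.ofGuard H))
    (v : VisibleSim (Closure S R) (.ofGuard G) (.ofGuard H))
    (s : SilentSim (Closure S R) (.ofGuard G) (.ofGuard H)) :
    SilentSim (Closure S R) (.rep G) (.rep H) := by
  intro X hs
  rcases hs.rep_inv with ⟨P₁, hs, c⟩ | ⟨-, a, b, P₁, P₂, h₁, h₂, c⟩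
  · obtain ⟨Q₁, hQ, hT⟩ := s _ hs
    obtain ⟨Q', hQ', e⟩ := (StructCong.rep_unfold H).expands.tauStar
      (TauStar.par (P := .rep H) .refl hQ)
    exact ⟨Q', hQ', .exp c.expands (.par (.rep h) hT) e⟩
  · obtain ⟨Q₁, hQ₁, hT₁⟩ := v _ _ (by simp) (by simp [Label.bn]) h₁
    obtain ⟨Q₂, hQ₂, hT₂⟩ := v _ _ (by simp) (by simp [Label.bn]) h₂
    have hc : StructCong (.rep H) (.par (.par (.rep H) (.ofGuard H)) (.ofGuard H)) :=
      (StructCong.rep_unfold H).trans (.par (.rep_unfold H) (.refl _))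
    obtain ⟨Q', hQ', e⟩ := hc.expands.tauStar
      ((hQ₁.parR (P := .rep H) (by simp [Label.bn])).commL hQ₂)
    exact ⟨Q', hQ', .exp c.expands (.par (.par (.rep h) hT₁) hT₂) e⟩

/-- Communications enabled by a renaming are matched by weak aliased communication. -/
theorem SilentSim.sub (hS : ClosedUnderTransitions S) (hW : WeakAliasedCommunication S)
    (hV : ∀ P Q, Closure S R P Q → VisibleSim (Closure S R) P Q) {P Q : Proc} (hP : P ∈ S)
    (hQ : Q ∈ S) (h : Closure S R P Q) (s : SilentSim (Closure S R) P Q) (σ : Name → Name) :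
    SilentSim (Closure S R) (P.subst σ) (Q.subst σ) := by
  intro X hs
  cases hs.substInv (P := P) rfl
      (P.fn ∪ Q.fn ∪ P.fn.image σ ∪ Q.fn.image σ) with
  | tau hs' e =>
    subst e
    obtain ⟨Q', hQ', hT⟩ := s _ hs'
    exact ⟨_, hQ'.subst σ, .sub σ (hS _ hP _ _ hs') (hS.tauStar hQ hQ') hT⟩
  | @comm a b c P₁ P₂ _ hac h₁ h₂ hX =>
    obtain ⟨Q₁, k₁, hT₁⟩ := hV _ _ h _ _ (by simp) (by simp [Label.bn]) h₁
    -- The pair `(P₁, Q₁)` is an arbitrary pair of the closure, beyond the reach of the induction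
    -- hypothesis; `hV` covers it.
    obtain ⟨Q₂, k₂, hT₂⟩ := hV _ _ hT₁ _ _ (by simp) (by simp [Label.bn]) h₂
    obtain ⟨N, hN, hc⟩ := (hW Q hQ).1 a b c Q₁ Q₂ σ k₁ k₂ hac
    exact ⟨N, hN, .exp hX.expands (.sub σ (hS _ (hS _ hP _ _ h₁) _ _ h₂)
      (hS.wStep (hS.wStep hQ k₁) k₂) hT₂) hc.expands⟩
  | @close a c d P₁ P₂ _ hac hd hcP h₁ h₂ hX =>
    simp only [Finset.mem_union, Finset.mem_image, not_or, not_exists, not_and] at hd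
    obtain ⟨⟨⟨hdP, hdQ⟩, hσP⟩, hσQ⟩ := hd
    have haP := h₁.bout_mem.1
    obtain ⟨Q₁, k₁, hT₁⟩ := hV _ _ h _ _ (by simp) (by simpa [Label.bn] using hdQ) h₁
    obtain ⟨Q₂, k₂, hT₂⟩ := hV _ _ hT₁ _ _ (by simp) (by simp [Label.bn]) h₂
    -- Weak aliased communication requires `d` to be fresh for the whole renaming, whereas `σ` is
    -- only known to avoid `d` on the free names of `P` and `Q`. Elsewhere `τ` fixes `d` and sends
    -- all other names to `d + 1`, an arbitrary value different from `d`.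
    let τ : Name → Name := fun x =>
      if x ∈ P.fn ∪ Q.fn then σ x else if x = d then d else d + 1
    have hτ : ∀ x ∈ P.fn ∪ Q.fn, τ x = σ x := fun x hx => if_pos hx
    have hdPQ : d ∉ P.fn ∪ Q.fn := by simp [hdP, hdQ]
    have hτd : τ d = d := by simp only [τ, if_neg hdPQ, if_true]
    have hτne : ∀ x, τ x = d → x = d := by
      intro x hx
      by_cases hxm : x ∈ P.fn ∪ Q.fn
      · rw [hτ x hxm] at hx
        rcases Finset.mem_union.1 hxm with h | h
        · exact absurd hx (hσP x h)
        · exact absurd hx (hσQ x h)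
      · by_contra hxd
        simp only [τ, if_neg hxm, if_neg hxd] at hx
        exact Nat.succ_ne_self d hx
    have hτac : τ a = τ c := by
      rw [hτ a (Finset.mem_union_left _ haP), hτ c (Finset.mem_union_left _ hcP), hac]
    obtain ⟨N, hN, hc⟩ := (hW Q hQ).2 a d c Q₁ Q₂ τ k₁ k₂ hτd hτne hτac
    rw [Tm.subst_congr (τ := σ) fun x hx => hτ x (Finset.mem_union_right _ hx)] at hN
    have hP₂ : ∀ x ∈ (nu d P₂).fn, x ∈ P.fn := by
      intro x hx
      obtain ⟨hx, hxd⟩ := mem_fn_nu.1 hx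
      refine (h₂.mem_fn hx).elim (fun h => (h₁.mem_fn h).elim id fun h => ?_) fun h => ?_
      · simp only [Label.names, Finset.mem_insert, Finset.mem_singleton, hxd, or_false] at h
        exact h ▸ haP
      · simp only [Label.names, Finset.mem_insert, Finset.mem_singleton, hxd, or_false] at h
        exact h ▸ hcP
    -- The free names of `(ν d)P₂` lie in `P`, so `τ` may replace `σ` there; it then passes under
    -- the restriction unchanged.
    rw [← Tm.subst_congr (σ := τ) fun x hx => hτ x (Finset.mem_union_left _ (hP₂ x hx)),
      nu_subst (c := d) fun x _ hxd e => hxd (hτne x e),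
      Function.update_eq_self_iff.2 hτd.symm] at hX
    exact ⟨N, hN, .exp hX.expands (.nu d (.sub τ (hS _ (hS _ hP _ _ h₁) _ _ h₂)
      (hS.wStep (hS.wStep hQ k₁) k₂) hT₂)) hc.expands⟩

theorem Closure.silentSim (hS : ClosedUnderTransitions S) (hW : WeakAliasedCommunication S)
    (hR : ∀ P Q, R P Q → ws (Closure S R) P Q) {P Q : Proc} (h : Closure S R P Q) :
    SilentSim (Closure S R) P Q := by
  induction h with
  | base h => exact (ws_iff.1 (hR _ _ h)).2
  | exp h₁ _ h₂ ih =>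
    intro P' hs
    obtain ⟨P₀', hs, e⟩ := h₁.unfold.1 _ _ (by simp [Label.bn]) hs
    -- The smaller process may answer a silent transition by standing still; then `Q` stands still
    -- too.
    rcases hs with rfl | hs
    · exact ⟨_, .refl, .exp e ‹_› h₂⟩
    · obtain ⟨Q₀', hs, hT⟩ := ih _ hs
      obtain ⟨Q', hs, e'⟩ := h₂.tauStar hs
      exact ⟨Q', hs, .exp e hT e'⟩
  | refl P => exact fun P' hs => ⟨P', .single hs, .refl _⟩
  | sub σ hP hQ h ih => exact .sub hS hW (fun _ _ h => h.visibleSim hS hR) hP hQ h ih σ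
  | perm π _ ih =>
    intro P' hs
    have hs' := hs.perm π.symm
    rw [subst_perm_symm] at hs'
    obtain ⟨Q', hQ, hT⟩ := ih _ hs'
    exact ⟨_, hQ.subst π, by simpa only [subst_symm_perm] using hT.perm π⟩
  | nu a _ ih =>
    intro P' hs
    rcases hs.nu_inv (by simp [Label.names]) with ⟨_, _, h, -⟩ | ⟨P', hs', rfl⟩
    · cases h
    · obtain ⟨Q', hQ, hT⟩ := ih _ hs'
      exact ⟨_, hQ.nu a, .nu a hT⟩
  | par h₁ h₂ ih₁ ih₂ =>
    exact .par h₁ h₂ (h₁.visibleSim hS hR) (h₂.visibleSim hS hR) ih₁ ih₂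
  | rep h ih => exact .rep h (h.visibleSim hS hR) ih
  | prog f g hf hf' _ _ _ _ => exact fun P' hs => ⟨_, .single (hf _ P' hs), hf' _ P' hs⟩

theorem Closure.ws (hS : ClosedUnderTransitions S) (hW : WeakAliasedCommunication S)
    (hR : ∀ P Q, R P Q → ws (Closure S R) P Q) {P Q : Proc} (h : Closure S R P Q) :
    ws (Closure S R) P Q :=
  ws_iff.2 ⟨h.visibleSim hS hR, h.silentSim hS hW hR⟩

/-! ## The up-to techniques are contained in the closure -/

theorem prefix_flip {U : BinRel Proc} {P Q : Proc}
    (h : (upTau ⊔ upOut ⊔ upInp ⊔ upRefl) U P Q) :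
    (upTau ⊔ upOut ⊔ upInp ⊔ upRefl) (flip U) Q P := by
  rcases h with ((⟨P₀, Q₀, h, rfl, rfl⟩ | ⟨a, b, P₀, Q₀, h, rfl, rfl⟩) |
    ⟨a, b, P₀, Q₀, h, rfl, rfl⟩) | rfl
  · exact .inl (.inl (.inl ⟨_, _, h, rfl, rfl⟩))
  · exact .inl (.inl (.inr ⟨_, _, _, _, h, rfl, rfl⟩))
  · exact .inl (.inr ⟨_, _, _, _, h, rfl, rfl⟩)
  · exact .inr rfl

theorem SumG.flip {U : BinRel Proc} {G H : Guard} (h : SumG U G H) : SumG (flip U) H G := by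
  induction h with
  | summand h => exact .summand (prefix_flip h)
  | plus _ _ ih₁ ih₂ => exact .plus ih₁ ih₂

/-- Summands with the same prefix match each other strongly, so only the continuations need to be
related by the closure. Choices preempted by silent transitions therefore cause no trouble. -/
theorem SumG.progress {U : BinRel Proc}
    (hU : ∀ P Q, U P Q → P ∈ S ∧ Q ∈ S ∧ Closure S R P Q) {G H : Guard} (h : SumG U G H) :
    ∀ μ P', Step (.ofGuard G) μ P' →
      ∃ Q', Step (.ofGuard H) μ Q' ∧ Closure S R P' Q' := by
  induction h with
  | summand h =>
    intro μ P' hs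
    rcases h with ((⟨P₀, Q₀, h, h₁, h₂⟩ | ⟨a, b, P₀, Q₀, h, h₁, h₂⟩) |
      ⟨a, b, P₀, Q₀, h, h₁, h₂⟩) | h
    · rw [h₁] at hs
      rw [h₂]
      cases hs
      exact ⟨_, .tau _, (hU _ _ h).2.2⟩
    · rw [h₁] at hs
      rw [h₂]
      cases hs
      exact ⟨_, .out _ _ _, (hU _ _ h).2.2⟩
    · rw [h₁] at hs
      rw [h₂]
      cases hs
      obtain ⟨hP, hQ, h⟩ := hU _ _ h
      refine ⟨_, .inp _ _ _, ?_⟩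
      rw [Tm.close_inst, Tm.close_inst]
      -- Receiving a name may identify it with a name already free in the body, which is a
      -- non-injective renaming; membership in `S` is what permits it.
      exact .sub _ hP hQ h
    · exact ⟨P', Eq.mp (congrArg (Step · μ P') h) hs, .refl _⟩
  | plus _ _ ih₁ ih₂ =>
    intro μ P' hs
    cases hs with
    | sumL hs =>
      obtain ⟨Q', hs, hT⟩ := ih₁ μ P' hs
      exact ⟨Q', .sumL hs, hT⟩
    | sumR hs =>
      obtain ⟨Q', hs, hT⟩ := ih₂ μ P' hs
      exact ⟨Q', .sumR hs, hT⟩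

theorem SumG.closure (hR : ∀ P Q, R P Q → R Q P) {U : BinRel Proc}
    (hU : ∀ P Q, U P Q → P ∈ S ∧ Q ∈ S ∧ Closure S R P Q) {G H : Guard} (h : SumG U G H) :
    Closure S R (.ofGuard G) (.ofGuard H) := by
  refine .of_progress (h.progress hU) fun μ Q' hs => ?_
  obtain ⟨P', hs, hT⟩ := h.flip.progress
    (fun P Q h => ⟨(hU _ _ h).2.1, (hU _ _ h).1, (hU _ _ h).2.2.symm hR⟩) μ Q' hs
  exact ⟨P', hs, hT.symm hR⟩

theorem Closure.nus (as : List Name) {P Q : Proc} (h : Closure S R P Q) :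
    Closure S R (nus as P) (PiCalc.nus as Q) := by
  induction as with
  | nil => exact h
  | cons a as ih => exact .nu a ih

theorem Closure.of_upTo (hR : ∀ P Q, R P Q → R Q P) {U : BinRel Proc}
    (hU : ∀ P Q, U P Q → P ∈ S ∧ Q ∈ S ∧ Closure S R P Q) {P Q : Proc}
    (h : (upExp ⊔ id ⊔ upRefl ⊔ upSub ⊔ upRes ⊔ upPcomp ⊔ upSumG ⊔ upRep ⊔ upTau ⊔ upOut ⊔
      upInp) U P Q) : Closure S R P Q := by
  have hpre : ∀ {G H : Guard}, (upTau ⊔ upOut ⊔ upInp ⊔ upRefl) U (.ofGuard G) (.ofGuard H) →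
      Closure S R (.ofGuard G) (.ofGuard H) := fun h => SumG.closure hR hU (.summand h)
  rcases h with (((((((((h | h) | h) | h) | h) | h) | h) | h) | h) | h) | h
  · obtain ⟨P₀, Q₀, h₁, h, h₂⟩ := h
    exact .exp h₁ (hU _ _ h).2.2 h₂
  · exact (hU _ _ h).2.2
  · cases h
    exact .refl _
  · obtain ⟨σ, P₀, Q₀, h, rfl, rfl⟩ := h
    exact .sub σ (hU _ _ h).1 (hU _ _ h).2.1 (hU _ _ h).2.2
  · obtain ⟨as, P₀, Q₀, h, rfl, rfl⟩ := h
    exact .nus as (hU _ _ h).2.2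
  · obtain ⟨P₁, Q₁, P₂, Q₂, h₁, h₂, rfl, rfl⟩ := h
    exact .par (hU _ _ h₁).2.2 (hU _ _ h₂).2.2
  · obtain ⟨G, H, h, rfl, rfl⟩ := h
    exact h.closure hR hU
  · obtain ⟨G, H, h, rfl, rfl⟩ := h
    exact .rep (hU _ _ h).2.2
  · obtain ⟨P₀, Q₀, h, rfl, rfl⟩ := h
    exact hpre (.inl (.inl (.inl ⟨_, _, h, rfl, rfl⟩)))
  · obtain ⟨a, b, P₀, Q₀, h, rfl, rfl⟩ := h
    exact hpre (.inl (.inl (.inr ⟨_, _, _, _, h, rfl, rfl⟩)))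
  · obtain ⟨a, b, P₀, Q₀, h, rfl, rfl⟩ := h
    exact hpre (.inl (.inr ⟨_, _, _, _, h, rfl, rfl⟩))

end Closure

/-- The closure of the symmetrization of a relation on `S`. -/
def symmClosure (S : Set Proc) (R : BinRel S) : BinRel Proc :=
  Closure S (extend S R ⊔ flip (extend S R))

/-- Each iterate is a relation on `S`, so every renaming in the next round acts on processes of `S`,
as the constructor `sub` demands. The closure itself may leave `S`. -/
theorem omegaIter_le_symmClosure (S : Set Proc) (R : BinRel S) (P Q : S)
    (h : omegaIter (restrict S (upExp ⊔ id ⊔ upRefl ⊔ upSub ⊔ upRes ⊔ upPcomp ⊔ upSumG ⊔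
      upRep ⊔ upTau ⊔ upOut ⊔ upInp)) R P Q) : symmClosure S R P Q := by
  simp only [omegaIter, iSup_apply, iSup_Prop_eq] at h
  obtain ⟨i, h⟩ := h
  induction i generalizing P Q with
  | zero => exact .base (.inl ⟨P.2, Q.2, h⟩)
  | succ i ih =>
    rw [Function.iterate_succ_apply'] at h
    refine Closure.of_upTo (fun _ _ h => h.symm) (fun P Q h => ?_) h
    obtain ⟨hP, hQ, h⟩ := h
    exact ⟨hP, hQ, ih _ _ h⟩

theorem ws_mono {T T' : BinRel Proc} (h : ∀ P Q, T P Q → T' P Q) {P Q : Proc}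
    (hw : ws T P Q) : ws T' P Q := fun μ P' hd hs => by
  obtain ⟨Q', hQ, hT⟩ := hw μ P' hd hs
  exact ⟨Q', hQ, h _ _ hT⟩

end PiCalc

theorem mainTheorem5 (S : Set PiCalc.Proc)
    (hclosed : PiCalc.ClosedUnderTransitions S)
    (hS : PiCalc.WeakAliasedCommunication S) :
    PiCalc.Sound (PiCalc.restrict S PiCalc.wbBar)
      (PiCalc.omegaIter (PiCalc.restrict S
        (PiCalc.upExp ⊔ id ⊔ PiCalc.upRefl ⊔ PiCalc.upSub ⊔ PiCalc.upRes ⊔ PiCalc.upPcomp ⊔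
          PiCalc.upSumG ⊔ PiCalc.upRep ⊔ PiCalc.upTau ⊔ PiCalc.upOut ⊔ PiCalc.upInp))) := by
  refine ⟨fun R P Q => PiCalc.symmClosure S R P Q,
    fun R P Q h => .base (.inl ⟨P.2, Q.2, h⟩), fun R hR => ?_⟩
  have hsymm : ∀ P Q, PiCalc.symmClosure S R P Q → PiCalc.symmClosure S R Q P :=
    fun P Q h => PiCalc.Closure.symm (fun _ _ h => h.symm) h
  have hbase : ∀ P Q, (PiCalc.extend S R ⊔ flip (PiCalc.extend S R)) P Q →
      PiCalc.ws (PiCalc.symmClosure S R) P Q := by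
    -- Pairs of `R` use the first half of `wb`; reversed pairs use the second half and the symmetry
    -- of the closure.
    rintro P Q (⟨hP, hQ, h⟩ | ⟨hQ, hP, h⟩)
    · refine PiCalc.ws_mono ?_ (hR _ _ h).2.1
      rintro P' Q' ⟨hP', hQ', h⟩
      exact PiCalc.omegaIter_le_symmClosure S R _ _ h
    · refine PiCalc.ws_mono ?_ (hR _ _ h).2.2
      rintro P' Q' ⟨hP', hQ', h⟩
      exact hsymm _ _ (PiCalc.omegaIter_le_symmClosure S R _ _ h)
  have hws : ∀ P Q, PiCalc.symmClosure S R P Q → PiCalc.ws (PiCalc.symmClosure S R) P Q :=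
    fun P Q h => PiCalc.Closure.ws hclosed hS hbase h
  intro P Q h
  -- The closure ranges over all processes, but derivatives of processes of `S` remain in `S`, so
  -- its restriction to `S` is still a bisimulation.
  refine ⟨⟨P.2, Q.2, h⟩, fun μ P' hd hs => ?_, fun μ Q' hd hs => ?_⟩
  · obtain ⟨Q', hQ, hT⟩ := hws _ _ h μ P' hd hs
    exact ⟨Q', hQ, hclosed _ P.2 _ _ hs, hclosed.wStepHat Q.2 hQ, hT⟩
  · obtain ⟨P', hP, hT⟩ := hws _ _ (hsymm _ _ h) μ Q' hd hs
    exact ⟨P', hP, hclosed.wStepHat P.2 hP, hclosed _ Q.2 _ _ hs, hsymm _ _ hT⟩
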